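/- Let $n\in\{1,2\}$ and let $\Omega\subset\mathbb R^n$ be open and bounded with smooth boundary. Let $H_0^1(\Omega)$ be the closure of $C_c^\infty(\Omega)$ in $H^1(\Omega)$ and $H^{-1}(\Omega)$ its dual space. For $v\in H^{-1}(\Omega)$ and $w\in H^2(\Omega)$, a function $u\in H^1_0(\Omega)$ is called a weak solution of $$\nabla\cdot(w^3\nabla u)=v\ \text{ in }\Omega,\qquad u=0\ \text{ on }\partial\Omega, \tag{1}$$ if $-\int_\Omega w^3\,\nabla u\cdot\nabla\varphi\,dx=\langle v,\varphi\rangle$ for all $\varphi\in H^1_0(\Omega)$; whenever (1) has exactly one weak solution, it is denoted by $\mathbf S_o(v,w)$. For $w_0\in H^2(\Omega)$ and $r>0$ write $B_r(w_0)=\{\psi\in H^2(\Omega):\|\psi-w_0\|_{H^2(\Omega)}\le r\}$. **Lemma.** There is a constant $C=C(\Omega)>0$ such that the following holds for every $w_0\in H^2(\Omega)$ with $\kappa:=\operatorname{ess\,inf}_{\Omega}w_0>0$ and every $r\in\left(0,\frac{\kappa}{2C}\right)$. (a) For all $v\in H^{-1}(\Omega)$ and $w\in B_r(w_0)$, problem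 (1) has a unique weak solution; moreover (1) has a unique weak solution for all right-hand sides in $H^{-1}(\Omega)$ and all coefficients in an $H^2(\Omega)$-neighbourhood of $w$, and the partial Fréchet derivatives $D_v\mathbf S_o(v,w):H^{-1}(\Omega)\to H^1_0(\Omega)$ and $D_w\mathbf S_o(v,w):H^2(\Omega)\to H^1_0(\Omega)$ exist. (b) Let $T\in(0,\infty)$, $v\in C([0,T];H^{-1}(\Omega))$ and $w\in C([0,T];B_r(w_0))$, and put $v_h(t)=v(t+h)-v(t)$, $w_h(t)=w(t+h)-w(t)$. Then, as $h\to0$, $$\alpha_1(h):=\sup_{\substack{t,\,t+h\in[0,T]\\ \tau\in[0,1]}}\left\|D_v\mathbf S_o\big(v(t)+\tau v_h(t),\,w(t)+\tau w_h(t)\big)-D_v\mathbf S_o\big(v(t),w(t)\big)\right\|_{\mathcal B(H^{-1}(\Omega),H_0^1(\Omega))}\longrightarrow0,$$ $$\alpha_2(h):=\sup_{\substack{t,\,t+h\in[0,T]\\ \tau\in[0,1]}}\left\|D_w\mathbf S_o\big(v(t)+\tau v_h(t),\,w(t)+\tau w_h(t)\big)-D_w\mathbf S_o\big(v(t),w(t)\big)\right\|_{\mathcal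 B(H^2(\Omega),H_0^1(\Omega))}\longrightarrow0.$$ -/

import Mathlib

open MeasureTheory Set Filter Topology
open scoped ContDiff ENNReal

noncomputable section

namespace MEMS

/-- The Euclidean space `ℝⁿ`. -/
abbrev E (n : ℕ) : Type := EuclideanSpace ℝ (Fin n)

/-- `Ω` has smooth boundary: near each boundary point, `Ω` is the sublevel set `{ρ < 0}` of a
smooth function `ρ` whose differential does not vanish at that point. -/
def HasSmoothBoundary {n : ℕ} (Ω : Set (E n)) : Prop :=
  ∀ x₀ ∈ frontier Ω, ∃ (U : Set (E n)) (ρ : E n → ℝ), IsOpen U ∧ x₀ ∈ U ∧ ContDiff ℝ ∞ ρ ∧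
    fderiv ℝ ρ x₀ ≠ 0 ∧ Ω ∩ U = {x | ρ x < 0} ∩ U

/-- The real Lebesgue space `L²(Ω)`. -/
abbrev L2 {n : ℕ} (Ω : Set (E n)) : Type := Lp ℝ 2 (volume.restrict Ω)

/-- Test functions: `φ ∈ C_c^∞(Ω)`. -/
structure IsTest {n : ℕ} (Ω : Set (E n)) (φ : E n → ℝ) : Prop where
  smooth : ContDiff ℝ ∞ φ
  compact : HasCompactSupport φ
  supp : tsupport φ ⊆ Ω

/-- The classical partial derivative `∂ᵢ φ`. -/
def pderiv {n : ℕ} (i : Fin n) (φ : E n → ℝ) (x : E n) : ℝ :=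
  fderiv ℝ φ x (EuclideanSpace.single i 1)

/-- `g ∈ L²(Ω)` is the weak partial derivative `∂ᵢ f` of `f ∈ L²(Ω)`. -/
def HasWeakPartial {n : ℕ} (Ω : Set (E n)) (i : Fin n) (f g : L2 Ω) : Prop :=
  ∀ φ : E n → ℝ, IsTest Ω φ →
    ∫ x in Ω, f x * pderiv i φ x = -∫ x in Ω, g x * φ x

section Helpers

variable {n : ℕ} {Ω : Set (E n)}

theorem IsTest.zero : IsTest Ω (0 : E n → ℝ) where
  smooth := contDiff_const
  compact := HasCompactSupport.zero
  supp := by simp [tsupport]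

theorem IsTest.add {φ ψ : E n → ℝ} (hφ : IsTest Ω φ) (hψ : IsTest Ω ψ) : IsTest Ω (φ + ψ) where
  smooth := hφ.smooth.add hψ.smooth
  compact := hφ.compact.add hψ.compact
  supp := (tsupport_add φ ψ).trans (union_subset hφ.supp hψ.supp)

theorem IsTest.smul {φ : E n → ℝ} (c : ℝ) (hφ : IsTest Ω φ) : IsTest Ω (c • φ) where
  smooth := hφ.smooth.const_smul c
  compact := hφ.compact.smul_left (f := fun _ => c)
  supp := (tsupport_smul_subset_right (fun _ => c) φ).trans hφ.supp

theorem integrable_mul_of_compact (f : L2 Ω) {ψ : E n → ℝ} (hc : Continuous ψ)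
    (hs : HasCompactSupport ψ) : Integrable (fun x => f x * ψ x) (volume.restrict Ω) :=
  (Lp.memLp f).integrable_mul ((hc.memLp_of_hasCompactSupport (p := 2) hs).restrict Ω)

theorem IsTest.integrable_mul (f : L2 Ω) {φ : E n → ℝ} (hφ : IsTest Ω φ) :
    Integrable (fun x => f x * φ x) (volume.restrict Ω) :=
  integrable_mul_of_compact f hφ.smooth.continuous hφ.compact

theorem IsTest.integrable_mul_pderiv (f : L2 Ω) {φ : E n → ℝ} (hφ : IsTest Ω φ) (i : Fin n) :
    Integrable (fun x => f x * pderiv i φ x) (volume.restrict Ω) :=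
  integrable_mul_of_compact f
    ((hφ.smooth.continuous_fderiv (by simp)).clm_apply continuous_const)
    (hφ.compact.fderiv_apply (𝕜 := ℝ) _)

theorem HasWeakPartial.zero (i : Fin n) : HasWeakPartial Ω i 0 0 := by
  intro φ _
  have h (ψ : E n → ℝ) : ∫ x in Ω, (0 : L2 Ω) x * ψ x = 0 := by
    refine integral_eq_zero_of_ae ?_
    filter_upwards [Lp.coeFn_zero ℝ 2 (volume.restrict Ω)] with x hx
    rw [hx]; simp
  rw [h, h, neg_zero]

theorem HasWeakPartial.add {i : Fin n} {f g f' g' : L2 Ω} (h : HasWeakPartial Ω i f g)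
    (h' : HasWeakPartial Ω i f' g') : HasWeakPartial Ω i (f + f') (g + g') := by
  intro φ hφ
  have e1 : ∫ x in Ω, (f + f') x * pderiv i φ x
      = ∫ x in Ω, (f x * pderiv i φ x + f' x * pderiv i φ x) := by
    refine integral_congr_ae ?_
    filter_upwards [Lp.coeFn_add f f'] with x hx
    rw [hx, Pi.add_apply, add_mul]
  have e2 : ∫ x in Ω, (g + g') x * φ x = ∫ x in Ω, (g x * φ x + g' x * φ x) := by
    refine integral_congr_ae ?_
    filter_upwards [Lp.coeFn_add g g'] with x hx
    rw [hx, Pi.add_apply, add_mul]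
  rw [e1, e2, integral_add (hφ.integrable_mul_pderiv f i) (hφ.integrable_mul_pderiv f' i),
    integral_add (hφ.integrable_mul g) (hφ.integrable_mul g'), h φ hφ, h' φ hφ]
  ring

theorem HasWeakPartial.smul {i : Fin n} {f g : L2 Ω} (c : ℝ) (h : HasWeakPartial Ω i f g) :
    HasWeakPartial Ω i (c • f) (c • g) := by
  intro φ hφ
  have e (k : L2 Ω) (ψ : E n → ℝ) :
      ∫ x in Ω, (c • k) x * ψ x = c * ∫ x in Ω, k x * ψ x := by
    rw [← integral_const_mul]
    refine integral_congr_ae ?_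
    filter_upwards [Lp.coeFn_smul c k] with x hx
    rw [hx, Pi.smul_apply, smul_eq_mul, mul_assoc]
  rw [e, e, h φ hφ, mul_neg]

end Helpers

/-- The set of all `(u, (∂ᵢ u)ᵢ)` with `u ∈ H¹(Ω)`, in the Hilbert sum of copies of `L²(Ω)`. -/
def sobolev1 {n : ℕ} (Ω : Set (E n)) :
    Submodule ℝ (WithLp 2 (L2 Ω × PiLp 2 (fun _ : Fin n => L2 Ω))) where
  carrier := {U | ∀ i, HasWeakPartial Ω i U.fst (U.snd i)}
  zero_mem' := fun i => HasWeakPartial.zero i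
  add_mem' := fun h h' i => (h i).add (h' i)
  smul_mem' := fun c _ h i => (h i).smul c

/-- The set of all `(w, (∂ᵢ w)ᵢ, (∂ⱼ ∂ᵢ w)ᵢⱼ)` with `w ∈ H²(Ω)`, in the Hilbert sum of copies of
`L²(Ω)`. -/
def sobolev2 {n : ℕ} (Ω : Set (E n)) :
    Submodule ℝ (WithLp 2 (L2 Ω × WithLp 2 (PiLp 2 (fun _ : Fin n => L2 Ω) ×
      PiLp 2 (fun _ : Fin n × Fin n => L2 Ω)))) where
  carrier := {W | (∀ i, HasWeakPartial Ω i W.fst (W.snd.fst i)) ∧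
    ∀ i j, HasWeakPartial Ω j (W.snd.fst i) (W.snd.snd (i, j))}
  zero_mem' := ⟨fun i => HasWeakPartial.zero i, fun _ j => HasWeakPartial.zero j⟩
  add_mem' := fun h h' => ⟨fun i => (h.1 i).add (h'.1 i), fun i j => (h.2 i j).add (h'.2 i j)⟩
  smul_mem' := fun c _ h => ⟨fun i => (h.1 i).smul c, fun i j => (h.2 i j).smul c⟩

/-- The Sobolev space `H¹(Ω)`, with the norm `‖u‖² = ‖u‖²_{L²} + ∑ᵢ ‖∂ᵢ u‖²_{L²}`. -/
def H1 {n : ℕ} (Ω : Set (E n)) : Type := sobolev1 Ω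

instance {n : ℕ} (Ω : Set (E n)) : NormedAddCommGroup (H1 Ω) :=
  inferInstanceAs (NormedAddCommGroup (sobolev1 Ω))

instance {n : ℕ} (Ω : Set (E n)) : NormedSpace ℝ (H1 Ω) :=
  inferInstanceAs (NormedSpace ℝ (sobolev1 Ω))

/-- The Sobolev space `H²(Ω)`, with the norm
`‖w‖² = ‖w‖²_{L²} + ∑ᵢ ‖∂ᵢ w‖²_{L²} + ∑ᵢⱼ ‖∂ⱼ ∂ᵢ w‖²_{L²}`. -/
def H2 {n : ℕ} (Ω : Set (E n)) : Type := sobolev2 Ω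

instance {n : ℕ} (Ω : Set (E n)) : NormedAddCommGroup (H2 Ω) :=
  inferInstanceAs (NormedAddCommGroup (sobolev2 Ω))

instance {n : ℕ} (Ω : Set (E n)) : NormedSpace ℝ (H2 Ω) :=
  inferInstanceAs (NormedSpace ℝ (sobolev2 Ω))

/-- The underlying `L²` function of an element of `H¹(Ω)`. -/
def H1.fn {n : ℕ} {Ω : Set (E n)} (u : H1 Ω) : L2 Ω := (Subtype.val u).fst

/-- The weak partial derivative `∂ᵢ u` of an element of `H¹(Ω)`. -/
def H1.grad {n : ℕ} {Ω : Set (E n)} (u : H1 Ω) (i : Fin n) : L2 Ω := (Subtype.val u).snd i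

/-- The underlying `L²` function of an element of `H²(Ω)`. -/
def H2.fn {n : ℕ} {Ω : Set (E n)} (w : H2 Ω) : L2 Ω := (Subtype.val w).fst

/-- The subspace `C_c^∞(Ω)` of `H¹(Ω)`. -/
def testSubmodule {n : ℕ} (Ω : Set (E n)) : Submodule ℝ (H1 Ω) where
  carrier := {u | ∃ φ : E n → ℝ, IsTest Ω φ ∧ H1.fn u =ᵐ[volume.restrict Ω] φ}
  zero_mem' := ⟨0, IsTest.zero, Lp.coeFn_zero ℝ 2 (volume.restrict Ω)⟩
  add_mem' := by
    rintro u u' ⟨φ, hφ, h⟩ ⟨φ', hφ', h'⟩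
    exact ⟨φ + φ', hφ.add hφ', (Lp.coeFn_add (H1.fn u) (H1.fn u')).trans (h.add h')⟩
  smul_mem' := by
    rintro c u ⟨φ, hφ, h⟩
    exact ⟨c • φ, hφ.smul c, (Lp.coeFn_smul c (H1.fn u)).trans (h.const_smul c)⟩

/-- `H¹₀(Ω)`: the closure of `C_c^∞(Ω)` in `H¹(Ω)`, with the norm of `H¹(Ω)`. -/
def H10 {n : ℕ} (Ω : Set (E n)) : Type := (testSubmodule Ω).topologicalClosure

instance {n : ℕ} (Ω : Set (E n)) : NormedAddCommGroup (H10 Ω) :=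
  inferInstanceAs (NormedAddCommGroup (testSubmodule Ω).topologicalClosure)

instance {n : ℕ} (Ω : Set (E n)) : NormedSpace ℝ (H10 Ω) :=
  inferInstanceAs (NormedSpace ℝ (testSubmodule Ω).topologicalClosure)

/-- The weak partial derivative `∂ᵢ u` of an element of `H¹₀(Ω)`. -/
def H10.grad {n : ℕ} {Ω : Set (E n)} (u : H10 Ω) (i : Fin n) : L2 Ω :=
  H1.grad (Subtype.val u) i

/-- `H⁻¹(Ω)`: the dual space of `H¹₀(Ω)`, with the dual norm. -/
abbrev Hneg1 {n : ℕ} (Ω : Set (E n)) : Type := H10 Ω →L[ℝ] ℝ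

/-- `u ∈ H¹₀(Ω)` is a weak solution of `∇ · (w³ ∇u) = v` in `Ω`, `u = 0` on `∂Ω`. -/
def IsWeakSolution {n : ℕ} (Ω : Set (E n)) (v : Hneg1 Ω) (w : H2 Ω) (u : H10 Ω) : Prop :=
  ∀ φ : H10 Ω,
    -∫ x in Ω, (H2.fn w x) ^ 3 * ∑ i, H10.grad u i x * H10.grad φ i x = v φ

open Classical in
/-- The solution operator `S_o(v, w)`: the unique weak solution of `∇ · (w³ ∇u) = v`, `u = 0` on
`∂Ω` (and `0` if the problem is not uniquely solvable). -/
def So {n : ℕ} (Ω : Set (E n)) (v : Hneg1 Ω) (w : H2 Ω) : H10 Ω :=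
  if h : ∃! u : H10 Ω, IsWeakSolution Ω v w u then h.choose else 0

/-- The partial Fréchet derivative `D_v S_o(v, w)`. -/
def DvSo {n : ℕ} (Ω : Set (E n)) (v : Hneg1 Ω) (w : H2 Ω) : Hneg1 Ω →L[ℝ] H10 Ω :=
  fderiv ℝ (fun v' : Hneg1 Ω => So Ω v' w) v

/-- The partial Fréchet derivative `D_w S_o(v, w)`. -/
def DwSo {n : ℕ} (Ω : Set (E n)) (v : Hneg1 Ω) (w : H2 Ω) : H2 Ω →L[ℝ] H10 Ω :=
  fderiv ℝ (fun w' : H2 Ω => So Ω v w') w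

/-- `α₁(h)`: the supremum over `t, t + h ∈ [0, T]`, `τ ∈ [0, 1]` of the operator norm of
`D_v S_o(v(t) + τ v_h(t), w(t) + τ w_h(t)) - D_v S_o(v(t), w(t))`, taken in `[0, ∞]`. -/
def alpha1 {n : ℕ} (Ω : Set (E n)) (T : ℝ) (v : ℝ → Hneg1 Ω) (w : ℝ → H2 Ω) (h : ℝ) : ℝ≥0∞ :=
  ⨆ (t : ℝ) (_ : t ∈ Icc 0 T) (_ : t + h ∈ Icc 0 T) (τ : ℝ) (_ : τ ∈ Icc (0 : ℝ) 1),
    ‖DvSo Ω (v t + τ • (v (t + h) - v t)) (w t + τ • (w (t + h) - w t)) - DvSo Ω (v t) (w t)‖ₑ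

/-- `α₂(h)`: the supremum over `t, t + h ∈ [0, T]`, `τ ∈ [0, 1]` of the operator norm of
`D_w S_o(v(t) + τ v_h(t), w(t) + τ w_h(t)) - D_w S_o(v(t), w(t))`, taken in `[0, ∞]`. -/
def alpha2 {n : ℕ} (Ω : Set (E n)) (T : ℝ) (v : ℝ → Hneg1 Ω) (w : ℝ → H2 Ω) (h : ℝ) : ℝ≥0∞ :=
  ⨆ (t : ℝ) (_ : t ∈ Icc 0 T) (_ : t + h ∈ Icc 0 T) (τ : ℝ) (_ : τ ∈ Icc (0 : ℝ) 1),
    ‖DwSo Ω (v t + τ • (v (t + h) - v t)) (w t + τ • (w (t + h) - w t)) - DwSo Ω (v t) (w t)‖ₑ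

end MEMS

end

/-! Let A(w) : H¹₀ → H⁻¹ be the operator u ↦ (φ ↦ ∫ w³ ∇u·∇φ), so that S_o(v, w) = -A(w)⁻¹v wherever
A(w) is invertible. If H² embeds in L^∞ with constant C, multiplication by w is a bounded operator
on L² depending linearly on w, so A is a cubic polynomial in w and hence smooth
(`SobolevBound.contDiff_op`). The bound r < κ/(2C) keeps w - w₀ below κ/2 almost everywhere, so w
stays away from zero on the ball; with Poincaré's inequality A(w) is coercive, and Lax–Milgram
inverts it. Invertible operators form an open set on which inversion is smooth, so S_o is smooth
near each point with w in the ball. This gives (a). For (b), the ball is convex and the parameters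
(t, s, τ) range over a compact set, so continuity of the derivatives becomes uniform continuity
(`tendsto_iSup_enorm_sub`).

The remaining ingredient is the embedding H² ⊂ L^∞ for n ≤ 2 (`exists_sobolevBound`). A smooth
boundary lets a small segment (n = 1) or parallelogram (n = 2) of fixed shape be attached inside Ω
to every point of Ω near a given point of its closure. Integrating once along each side bounds a
mollification of w at the vertex by an integral of its derivatives of order at most n. That integral
is controlled by the H² norm uniformly in the mollifier, and compactness of the closure makes the
constant global. -/

noncomputable section

namespace MEMS

/-! ### Completeness of H¹ and H¹₀ -/

section Hilbert

variable {n : ℕ} {Ω : Set (E n)}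

instance : InnerProductSpace ℝ (H1 Ω) := inferInstanceAs (InnerProductSpace ℝ (sobolev1 Ω))

instance : InnerProductSpace ℝ (H10 Ω) :=
  inferInstanceAs (InnerProductSpace ℝ (testSubmodule Ω).topologicalClosure)

theorem integral_mul_eq_inner (f : L2 Ω) {ψ : E n → ℝ} (hψ : MemLp ψ 2 (volume.restrict Ω)) :
    ∫ x in Ω, f x * ψ x = inner ℝ f hψ.toLp := by
  rw [L2.inner_def]
  refine integral_congr_ae ?_
  filter_upwards [hψ.coeFn_toLp] with x hx
  simp [hx, mul_comm]

theorem IsTest.memLp {φ : E n → ℝ} (hφ : IsTest Ω φ) : MemLp φ 2 (volume.restrict Ω) :=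
  (hφ.smooth.continuous.memLp_of_hasCompactSupport hφ.compact).restrict Ω

theorem IsTest.pderiv {φ : E n → ℝ} (hφ : IsTest Ω φ) (i : Fin n) : IsTest Ω (pderiv i φ) where
  smooth := (hφ.smooth.fderiv_right (m := ∞) (by simp)).clm_apply contDiff_const
  compact := hφ.compact.fderiv_apply (𝕜 := ℝ) _
  supp := (tsupport_fderiv_apply_subset ℝ _).trans hφ.supp

/-- Pairings with fixed L² vectors are continuous in (f, g), so in this form the condition is
visibly closed; this makes H¹ complete, as Lax–Milgram requires. -/
theorem hasWeakPartial_iff_inner {i : Fin n} {f g : L2 Ω} :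
    HasWeakPartial Ω i f g ↔ ∀ (φ : E n → ℝ) (hφ : IsTest Ω φ),
      inner ℝ f ((hφ.pderiv i).memLp.toLp) = -inner ℝ g (hφ.memLp.toLp) := by
  unfold HasWeakPartial
  refine forall₂_congr fun φ hφ => ?_
  rw [integral_mul_eq_inner f (hφ.pderiv i).memLp, integral_mul_eq_inner g hφ.memLp]

theorem isClosed_sobolev1 : IsClosed (sobolev1 Ω : Set (WithLp 2 (L2 Ω × PiLp 2 (fun _ : Fin n => L2 Ω)))) := by
  have : (sobolev1 Ω : Set (WithLp 2 (L2 Ω × PiLp 2 (fun _ : Fin n => L2 Ω)))) =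
      {U | ∀ i, ∀ (φ : E n → ℝ) (hφ : IsTest Ω φ),
      inner ℝ U.fst ((hφ.pderiv i).memLp.toLp) = -inner ℝ (U.snd i) (hφ.memLp.toLp)} := by
    ext U
    exact forall_congr' fun i => hasWeakPartial_iff_inner
  rw [this]
  simp only [Set.ofPred_forall]
  refine isClosed_iInter fun i => isClosed_iInter fun φ => isClosed_iInter fun hφ => ?_
  have h1 : Continuous fun U : WithLp 2 (L2 Ω × PiLp 2 (fun _ : Fin n => L2 Ω)) => U.fst :=
    by fun_prop
  have h2 : Continuous fun U : WithLp 2 (L2 Ω × PiLp 2 (fun _ : Fin n => L2 Ω)) => U.snd i :=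
    by fun_prop
  exact isClosed_eq (h1.inner continuous_const) (h2.inner continuous_const).neg

instance : CompleteSpace (H1 Ω) :=
  (isClosed_sobolev1 (Ω := Ω)).completeSpace_coe

instance : CompleteSpace (H10 Ω) :=
  (testSubmodule Ω).isClosed_topologicalClosure.completeSpace_coe

/-- The inclusion of `H¹(Ω)` into `L²(Ω)`. -/
def H1.fnL : H1 Ω →L[ℝ] L2 Ω :=
  (WithLp.fstL 2 ℝ (L2 Ω) (PiLp 2 (fun _ : Fin n => L2 Ω))).comp (sobolev1 Ω).subtypeL

/-- The weak partial derivative as a continuous linear map on `H¹(Ω)`. -/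
def H1.gradL (i : Fin n) : H1 Ω →L[ℝ] L2 Ω :=
  ((PiLp.proj 2 (fun _ : Fin n => L2 Ω) i).comp
    (WithLp.sndL 2 ℝ (L2 Ω) (PiLp 2 (fun _ : Fin n => L2 Ω)))).comp (sobolev1 Ω).subtypeL

/-- The inclusion of `H¹₀(Ω)` into `H¹(Ω)`. -/
def H10.toH1 : H10 Ω →L[ℝ] H1 Ω := (testSubmodule Ω).topologicalClosure.subtypeL

/-- The weak partial derivative as a continuous linear map on `H¹₀(Ω)`. -/
def H10.gradL (i : Fin n) : H10 Ω →L[ℝ] L2 Ω := (H1.gradL i).comp H10.toH1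

theorem H10.gradL_apply (u : H10 Ω) (i : Fin n) : H10.gradL i u = H10.grad u i := rfl

theorem H1.norm_sq (u : H1 Ω) : ‖u‖ ^ 2 = ‖H1.fn u‖ ^ 2 + ∑ i, ‖H1.grad u i‖ ^ 2 := by
  have h : ‖u‖ = ‖u.val‖ := rfl
  rw [h, WithLp.prod_norm_sq_eq_of_L2, PiLp.norm_sq_eq_of_L2]
  rfl

theorem H1.hasWeakPartial (u : H1 Ω) (i : Fin n) : HasWeakPartial Ω i (H1.fn u) (H1.grad u i) :=
  u.property i

theorem H2.norm_fn_le (w : H2 Ω) : ‖H2.fn w‖ ≤ ‖w‖ := WithLp.norm_fst_le _ _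

end Hilbert

/-! ### Poincaré's inequality on bounded sets -/

section Poincare
variable {n : ℕ} {Ω : Set (E n)}

theorem IsTest.mul_left {φ ψ : E n → ℝ} (hφ : IsTest Ω φ) (hψ : ContDiff ℝ ∞ ψ) :
    IsTest Ω (fun x => ψ x * φ x) where
  smooth := hψ.mul hφ.smooth
  compact := hφ.compact.mul_left
  supp := (tsupport_mul_subset_right).trans hφ.supp

theorem IsTest.integral_pderiv {φ : E n → ℝ} (hφ : IsTest Ω φ) (i : Fin n) :
    ∫ x, MEMS.pderiv i φ x = 0 := by
  have := integral_mul_fderiv_eq_neg_fderiv_mul_of_integrable (μ := (volume : Measure (E n)))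
    (f := fun _ : E n => (1 : ℝ)) (g := φ) (v := EuclideanSpace.single i (1 : ℝ)) (by simp)
    (by
      simp only [one_mul]
      exact (hφ.pderiv i).smooth.continuous.integrable_of_hasCompactSupport (hφ.pderiv i).compact)
    (by simpa using hφ.smooth.continuous.integrable_of_hasCompactSupport hφ.compact)
    (by fun_prop) (fun x _ => hφ.smooth.differentiable (by simp) x)
  simpa [MEMS.pderiv] using this

theorem IsTest.setIntegral_eq {φ : E n → ℝ} (hφ : IsTest Ω φ) : ∫ x in Ω, φ x = ∫ x, φ x :=
  setIntegral_eq_integral_of_forall_compl_eq_zero fun x hx => by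
    by_contra h
    exact hx (hφ.supp (subset_tsupport _ h))

/-- With p(x) = xᵢ, integrating ∂ᵢ(φ · pφ) = 2φ ∂ᵢ(pφ) - φ² gives ∫ φ² = 2 ∫ φ ∂ᵢ(pφ). The test
function pφ then moves the derivative onto the weak gradient of u, which need not be identified with
∂ᵢφ. Cauchy–Schwarz and |p| ≤ R on Ω finish. -/
theorem norm_fn_le_of_mem_testSubmodule {R : ℝ} (hR0 : 0 ≤ R) (hΩ : MeasurableSet Ω) (hR : ∀ x ∈ Ω, ‖x‖ ≤ R) (i : Fin n)
    {u : H1 Ω} (hu : u ∈ testSubmodule Ω) : ‖H1.fn u‖ ≤ 2 * R * ‖H1.grad u i‖ := by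
  obtain ⟨φ, hφ, huφ⟩ := hu
  set p : E n → ℝ := fun x => x i with hp
  have hpc : ContDiff ℝ ∞ p := by
    rw [hp]; fun_prop
  have hpd (x : E n) : HasFDerivAt p (PiLp.proj (𝕜 := ℝ) 2 (fun _ : Fin n => ℝ) i) x :=
    (PiLp.proj (𝕜 := ℝ) 2 (fun _ : Fin n => ℝ) i).hasFDerivAt
  have hφd (x : E n) : HasFDerivAt φ (fderiv ℝ φ x) x :=
    (hφ.smooth.differentiable (by simp) x).hasFDerivAt
  have hψ := hφ.mul_left hpc
  have hχ := hψ.mul_left hφ.smooth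
  have e1 (x : E n) : pderiv i (fun x => p x * φ x) x = p x * pderiv i φ x + φ x := by
    change fderiv ℝ (p * φ) x _ = _
    rw [((hpd x).mul (hφd x)).fderiv]
    simp [pderiv]
  have e2 (x : E n) : pderiv i (fun x => φ x * (p x * φ x)) x
      = 2 * (φ x * pderiv i (fun x => p x * φ x) x) - φ x * φ x := by
    rw [e1]
    change fderiv ℝ (φ * (p * φ)) x _ = _
    rw [((hφd x).mul ((hpd x).mul (hφd x))).fderiv]
    simp [pderiv]
    ring
  have h0 : ∫ x in Ω, pderiv i (fun x => φ x * (p x * φ x)) x = 0 := by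
    rw [(hχ.pderiv i).setIntegral_eq, hχ.integral_pderiv]
  have i1 : IntegrableOn (fun x => φ x * pderiv i (fun x => p x * φ x) x) Ω :=
    hφ.memLp.integrable_mul (hψ.pderiv i).memLp
  have i2 : IntegrableOn (fun x => φ x * φ x) Ω := hφ.memLp.integrable_mul hφ.memLp
  simp only [e2] at h0
  rw [integral_sub (i1.const_mul 2) i2, integral_const_mul] at h0
  have h1 : ∫ x in Ω, φ x * pderiv i (fun x => p x * φ x) x
      = -∫ x in Ω, H1.grad u i x * (p x * φ x) := by
    rw [← H1.hasWeakPartial u i _ hψ]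
    refine integral_congr_ae ?_
    filter_upwards [huφ] with x hx
    rw [hx]
  have h2 : ∫ x in Ω, φ x * φ x = ‖H1.fn u‖ ^ 2 := by
    rw [← real_inner_self_eq_norm_sq, L2.inner_def]
    refine integral_congr_ae ?_
    filter_upwards [huφ] with x hx
    simp [hx, sq]
  have h3 : |∫ x in Ω, H1.grad u i x * (p x * φ x)| ≤ ‖H1.grad u i‖ * (R * ‖H1.fn u‖) := by
    rw [integral_mul_eq_inner _ hψ.memLp]
    refine (abs_real_inner_le_norm _ _).trans ?_
    gcongr
    refine Lp.norm_le_mul_norm_of_ae_le_mul ?_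
    filter_upwards [hψ.memLp.coeFn_toLp, huφ, ae_restrict_mem hΩ] with x h1 h2 h3
    rw [h1, h2, norm_mul]
    gcongr
    exact (PiLp.norm_apply_le x i).trans (hR x h3)
  have h4 : ‖H1.fn u‖ ^ 2 ≤ (2 * R * ‖H1.grad u i‖) * ‖H1.fn u‖ := by
    have := neg_abs_le (∫ x in Ω, H1.grad u i x * (p x * φ x))
    nlinarith
  rcases (norm_nonneg (H1.fn u)).eq_or_lt with h | h
  · rw [← h]
    positivity
  · rw [sq] at h4
    exact le_of_mul_le_mul_right h4 h

theorem norm_fn_le_norm_grad {R : ℝ} (hR0 : 0 ≤ R) (hΩ : MeasurableSet Ω) (hR : ∀ x ∈ Ω, ‖x‖ ≤ R) (i : Fin n)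
    (u : H10 Ω) : ‖H1.fn (H10.toH1 u)‖ ≤ 2 * R * ‖H10.grad u i‖ := by
  have hc : IsClosed {u : H1 Ω | ‖H1.fnL u‖ ≤ 2 * R * ‖H1.gradL i u‖} :=
    isClosed_le (by fun_prop) (by fun_prop)
  exact closure_minimal (fun u hu => norm_fn_le_of_mem_testSubmodule hR0 hΩ hR i hu) hc u.property

theorem exists_norm_sq_le_sum_grad (hn : 0 < n) (hΩ : MeasurableSet Ω) (hb : Bornology.IsBounded Ω) :
    ∃ K : ℝ, 0 < K ∧ ∀ u : H10 Ω, K * ‖u‖ ^ 2 ≤ ∑ i, ‖H10.grad u i‖ ^ 2 := by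
  obtain ⟨R, hR0, hR⟩ := hb.exists_pos_norm_le
  refine ⟨((2 * R) ^ 2 + 1)⁻¹, by positivity, fun u => ?_⟩
  rw [inv_mul_le_iff₀ (by positivity)]
  have h1 : ‖u‖ = ‖H10.toH1 u‖ := rfl
  have h2 := norm_fn_le_norm_grad hR0.le hΩ hR ⟨0, hn⟩ u
  have h3 : ‖H10.grad u ⟨0, hn⟩‖ ^ 2 ≤ ∑ i, ‖H10.grad u i‖ ^ 2 :=
    Finset.single_le_sum (f := fun i => ‖H10.grad u i‖ ^ 2) (fun i _ => sq_nonneg _) (Finset.mem_univ _)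
  have h4 : ‖H1.fn (H10.toH1 u)‖ ^ 2 ≤ (2 * R) ^ 2 * ‖H10.grad u ⟨0, hn⟩‖ ^ 2 := by
    rw [← mul_pow]
    gcongr
  have h5 : ∑ i, ‖H1.grad (H10.toH1 u) i‖ ^ 2 = ∑ i, ‖H10.grad u i‖ ^ 2 := rfl
  rw [h1, H1.norm_sq, h5]
  nlinarith [sq_nonneg (2 * R)]

end Poincare

/-! ### The operator A(w) and its coercivity -/

section Multiplication
variable {n : ℕ} {Ω : Set (E n)}

/-- `H²(Ω)` is continuously embedded in `L^∞(Ω)` with constant `C`. -/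
def SobolevBound (Ω : Set (E n)) (C : ℝ) : Prop :=
  ∀ w : H2 Ω, ∀ᵐ x ∂volume.restrict Ω, |H2.fn w x| ≤ C * ‖w‖

theorem SobolevBound.memLp_top {C : ℝ} (hC : SobolevBound Ω C) (w : H2 Ω) :
    MemLp (H2.fn w) ∞ (volume.restrict Ω) :=
  memLp_top_of_bound (Lp.aestronglyMeasurable _) _ (hC w)

/-- The embedding of `H²(Ω)` in `L^∞(Ω)`. -/
def SobolevBound.toLinfty {C : ℝ} (hC : SobolevBound Ω C) (h0 : 0 ≤ C) :
    H2 Ω →L[ℝ] Lp ℝ ∞ (volume.restrict Ω) :=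
  LinearMap.mkContinuous
    { toFun := fun w => (hC.memLp_top w).toLp
      map_add' := fun w w' => by
        rw [← MemLp.toLp_add]
        exact MemLp.toLp_congr _ _ (Lp.coeFn_add (H2.fn w) (H2.fn w'))
      map_smul' := fun c w => by
        rw [RingHom.id_apply, ← MemLp.toLp_const_smul]
        exact MemLp.toLp_congr _ _ (Lp.coeFn_smul c (H2.fn w)) } C
    fun w => by
      refine (Lp.norm_toLp _ (hC.memLp_top w)).le.trans (ENNReal.toReal_le_of_le_ofReal (by positivity) ?_)
      rw [eLpNorm_exponent_top]
      exact eLpNormEssSup_le_of_ae_bound (hC w)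

/-- Multiplication of `L²(Ω)` functions by an `H²(Ω)` function. -/
def SobolevBound.mulL {C : ℝ} (hC : SobolevBound Ω C) (h0 : 0 ≤ C) :
    H2 Ω →L[ℝ] L2 Ω →L[ℝ] L2 Ω :=
  ((ContinuousLinearMap.mul ℝ ℝ).holderL (volume.restrict Ω) ∞ 2 2).comp (hC.toLinfty h0)

theorem SobolevBound.coeFn_mulL {C : ℝ} (hC : SobolevBound Ω C) (h0 : 0 ≤ C) (w : H2 Ω)
    (f : L2 Ω) : hC.mulL h0 w f =ᵐ[volume.restrict Ω] fun x => H2.fn w x * f x := by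
  have h1 := (ContinuousLinearMap.mul ℝ ℝ).coeFn_holder (r := 2) (hC.toLinfty h0 w) f
  have h2 : hC.toLinfty h0 w =ᵐ[volume.restrict Ω] H2.fn w := (hC.memLp_top w).coeFn_toLp
  filter_upwards [h1, h2] with x h1 h2
  rw [← h2]
  exact h1

theorem SobolevBound.coeFn_mulL_pow {C : ℝ} (hC : SobolevBound Ω C) (h0 : 0 ≤ C) (w : H2 Ω)
    (f : L2 Ω) (k : ℕ) :
    (hC.mulL h0 w ^ k) f =ᵐ[volume.restrict Ω] fun x => H2.fn w x ^ k * f x := by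
  induction k with
  | zero => simp
  | succ k ih =>
    rw [pow_succ']
    filter_upwards [hC.coeFn_mulL h0 w ((hC.mulL h0 w ^ k) f), ih] with x h1 h2
    rw [mul_apply_eq_comp, h1, h2, pow_succ', mul_assoc]

/-- The operator `u ↦ (φ ↦ ∫ w³ ∇u · ∇φ)` from `H¹₀(Ω)` to `H⁻¹(Ω)`. -/
def SobolevBound.op {C : ℝ} (hC : SobolevBound Ω C) (h0 : 0 ≤ C) (w : H2 Ω) :
    H10 Ω →L[ℝ] Hneg1 Ω :=
  ∑ i, ((ContinuousLinearMap.compL ℝ (H10 Ω) (L2 Ω) ℝ).flip (H10.gradL i)).comp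
    ((innerSL ℝ).comp ((hC.mulL h0 w ^ 3).comp (H10.gradL i)))

theorem SobolevBound.op_apply {C : ℝ} (hC : SobolevBound Ω C) (h0 : 0 ≤ C) (w : H2 Ω)
    (u φ : H10 Ω) :
    hC.op h0 w u φ = ∑ i, inner ℝ ((hC.mulL h0 w ^ 3) (H10.grad u i)) (H10.grad φ i) := by
  simp [SobolevBound.op, H10.gradL_apply]

theorem SobolevBound.contDiff_op {C : ℝ} (hC : SobolevBound Ω C) (h0 : 0 ≤ C) :
    ContDiff ℝ ∞ (hC.op h0) := by
  unfold SobolevBound.op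
  refine ContDiff.sum fun i _ => ?_
  refine contDiff_const.clm_comp (contDiff_const.clm_comp (ContDiff.clm_comp ?_ contDiff_const))
  -- Multiplication by w³ is the cube, in the operator algebra on L², of a map linear in w.
  exact (hC.mulL h0).contDiff.pow 3

theorem SobolevBound.op_eq_integral {C : ℝ} (hC : SobolevBound Ω C) (h0 : 0 ≤ C) (w : H2 Ω)
    (u φ : H10 Ω) :
    hC.op h0 w u φ = ∫ x in Ω, (H2.fn w x) ^ 3 * ∑ i, H10.grad u i x * H10.grad φ i x := by
  rw [hC.op_apply]
  simp only [L2.inner_def]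
  rw [← integral_finsetSum]
  · refine integral_congr_ae ?_
    filter_upwards [ae_all_iff.2 fun i => hC.coeFn_mulL_pow h0 w (H10.grad u i) 3] with x hx
    simp only [hx, Finset.mul_sum]
    exact Finset.sum_congr rfl fun i _ => by simp; ring
  · exact fun i _ => L2.integrable_inner _ _

theorem SobolevBound.isWeakSolution_iff {C : ℝ} (hC : SobolevBound Ω C) (h0 : 0 ≤ C)
    {v : Hneg1 Ω} {w : H2 Ω} {u : H10 Ω} : IsWeakSolution Ω v w u ↔ -hC.op h0 w u = v := by
  rw [ContinuousLinearMap.ext_iff]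
  refine forall_congr' fun φ => ?_
  rw [← hC.op_eq_integral h0, neg_apply]

theorem SobolevBound.op_coercive {C : ℝ} (hC : SobolevBound Ω C) (h0 : 0 ≤ C) {w : H2 Ω} {c : ℝ}
    (hc : 0 ≤ c) (hw : ∀ᵐ x ∂volume.restrict Ω, c ≤ H2.fn w x) (u : H10 Ω) :
    c ^ 3 * ∑ i, ‖H10.grad u i‖ ^ 2 ≤ hC.op h0 w u u := by
  rw [hC.op_apply, Finset.mul_sum]
  refine Finset.sum_le_sum fun i _ => ?_
  rw [← real_inner_self_eq_norm_sq, ← real_inner_smul_left]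
  simp only [L2.inner_def]
  refine integral_mono_ae (L2.integrable_inner _ _) (L2.integrable_inner _ _) ?_
  filter_upwards [hC.coeFn_mulL_pow h0 w (H10.grad u i) 3, Lp.coeFn_smul (c ^ 3) (H10.grad u i), hw]
    with x h1 h2 h3
  simp only [h1, h2, Pi.smul_apply, smul_eq_mul, RCLike.inner_apply, conj_trivial]
  have : c ^ 3 ≤ H2.fn w x ^ 3 := by gcongr
  nlinarith [mul_self_nonneg (H10.grad u i x)]

/-- An operator from a real Hilbert space to its dual whose quadratic form is coercive is
invertible. -/
theorem isInvertible_of_coercive {V : Type*} [NormedAddCommGroup V] [InnerProductSpace ℝ V]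
    [CompleteSpace V] {B : V →L[ℝ] V →L[ℝ] ℝ} (hB : IsCoercive B) : B.IsInvertible := by
  refine ⟨hB.continuousLinearEquivOfBilin.trans
    (InnerProductSpace.toDual ℝ V).toContinuousLinearEquiv, ?_⟩
  ext u v
  simp

theorem SobolevBound.op_isInvertible (hn : 0 < n) (hΩ : MeasurableSet Ω)
    (hb : Bornology.IsBounded Ω) {C : ℝ} (hC : SobolevBound Ω C) (h0 : 0 ≤ C) {w : H2 Ω} {c : ℝ}
    (hc : 0 < c) (hw : ∀ᵐ x ∂volume.restrict Ω, c ≤ H2.fn w x) : (hC.op h0 w).IsInvertible := by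
  obtain ⟨K, hK, h⟩ := exists_norm_sq_le_sum_grad hn hΩ hb
  refine isInvertible_of_coercive ⟨c ^ 3 * K, by positivity, fun u => ?_⟩
  calc c ^ 3 * K * ‖u‖ * ‖u‖ = c ^ 3 * (K * ‖u‖ ^ 2) := by ring
    _ ≤ c ^ 3 * ∑ i, ‖H10.grad u i‖ ^ 2 := by gcongr; exact h u
    _ ≤ _ := hC.op_coercive h0 hc.le hw u

/-- The embedding gives |w - w₀| ≤ C r ≤ κ/2 a.e., and w₀ > 3κ/4 a.e., so w ≥ κ/4. -/
theorem SobolevBound.op_isInvertible_of_mem_closedBall (hn : 0 < n) (hΩ : MeasurableSet Ω)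
    (hb : Bornology.IsBounded Ω) {C : ℝ} (hC : SobolevBound Ω C) (h0 : 0 < C) {w₀ w : H2 Ω}
    {κ r : ℝ} (hκ : κ = essInf (H2.fn w₀) (volume.restrict Ω)) (hκ0 : 0 < κ)
    (hr : r < κ / (2 * C)) (hw : w ∈ Metric.closedBall w₀ r) : (hC.op h0.le w).IsInvertible := by
  refine hC.op_isInvertible hn hΩ hb h0.le (half_pos (half_pos hκ0)) ?_
  -- The real `essInf` is a supremum of a.e. lower bounds, equal to 0 by convention if there are
  -- none; κ > 0 excludes that case. Asking only for a bound above 3κ/4 avoids proving that the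
  -- supremum is attained.
  obtain ⟨b, hb, hb'⟩ : ∃ b ∈ {a | ∀ᶠ x in ae (volume.restrict Ω), a ≤ H2.fn w₀ x}, 3 * κ / 4 < b := by
    have hs : κ = sSup {a | ∀ᶠ x in ae (volume.restrict Ω), a ≤ H2.fn w₀ x} := by
      rw [hκ, essInf, liminf_eq]
    refine exists_lt_of_lt_csSup ?_ (by linarith)
    by_contra hne
    rw [not_nonempty_iff_eq_empty.1 hne, Real.sSup_empty] at hs
    exact hκ0.ne' hs
  filter_upwards [hb, hC (w - w₀), Lp.coeFn_sub (H2.fn w) (H2.fn w₀)] with x h1 h2 h3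
  have h4 : H2.fn (w - w₀) x = H2.fn w x - H2.fn w₀ x := h3
  rw [mem_closedBall_iff_norm] at hw
  rw [h4] at h2
  have h5 : C * ‖w - w₀‖ ≤ κ / 2 := by
    rw [lt_div_iff₀ (by positivity)] at hr
    nlinarith
  linarith [neg_abs_le (H2.fn w x - H2.fn w₀ x)]

end Multiplication

/-! ### Smoothness of the solution operator -/

section SolutionOperator
variable {n : ℕ} {Ω : Set (E n)} {C : ℝ} (hC : SobolevBound Ω C) (h0 : 0 ≤ C)

theorem SobolevBound.existsUnique {w : H2 Ω} (hw : (hC.op h0 w).IsInvertible) (v : Hneg1 Ω) :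
    ∃! u : H10 Ω, IsWeakSolution Ω v w u := by
  obtain ⟨e, he⟩ := hw
  have h (u : H10 Ω) : IsWeakSolution Ω v w u ↔ u = e.symm (-v) := by
    rw [hC.isWeakSolution_iff h0, ← he, neg_eq_iff_eq_neg, ContinuousLinearEquiv.coe_coe,
      ContinuousLinearEquiv.eq_symm_apply]
  exact ⟨e.symm (-v), (h _).2 rfl, fun u hu => (h u).1 hu⟩

/-- `(v, w) ↦ -A(w)⁻¹ v`, which is the solution operator where `A(w)` is invertible. -/
def SobolevBound.sol (p : Hneg1 Ω × H2 Ω) : H10 Ω :=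
  -(hC.op h0 p.2).inverse p.1

theorem SobolevBound.So_eq {w : H2 Ω} (hw : (hC.op h0 w).IsInvertible) (v : Hneg1 Ω) :
    So Ω v w = hC.sol h0 (v, w) := by
  have h := hC.existsUnique h0 hw v
  have h1 : IsWeakSolution Ω v w (So Ω v w) := by
    rw [So, dif_pos h]
    exact h.choose_spec.1
  refine h.unique h1 ?_
  rw [hC.isWeakSolution_iff h0, sol]
  obtain ⟨e, he⟩ := hw
  simp [← he]

theorem SobolevBound.eventually_isInvertible {w : H2 Ω} (hw : (hC.op h0 w).IsInvertible) :
    ∀ᶠ w' in 𝓝 w, (hC.op h0 w').IsInvertible := by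
  obtain ⟨e, he⟩ := hw
  have h := ContinuousLinearEquiv.nhds e
  rw [he] at h
  exact (hC.contDiff_op h0).continuous.continuousAt h

/-- Operator inversion is smooth at invertible operators between complete spaces, and A is smooth in
w. -/
theorem SobolevBound.contDiffAt_sol {w : H2 Ω} (hw : (hC.op h0 w).IsInvertible) (v : Hneg1 Ω) :
    ContDiffAt ℝ ∞ (hC.sol h0) (v, w) := by
  refine ContDiffAt.neg (ContDiffAt.clm_apply ?_ contDiffAt_fst)
  exact ContDiffAt.comp (v, w) (g := ContinuousLinearMap.inverse) hw.contDiffAt_map_inverse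
    ((hC.contDiff_op h0).contDiffAt.comp (v, w) contDiffAt_snd)

theorem SobolevBound.hasFDerivAt_So_left {w : H2 Ω} (hw : (hC.op h0 w).IsInvertible)
    (v : Hneg1 Ω) : HasFDerivAt (fun v' : Hneg1 Ω => So Ω v' w)
      ((fderiv ℝ (hC.sol h0) (v, w)).comp (ContinuousLinearMap.inl ℝ _ _)) v := by
  have h := ((hC.contDiffAt_sol h0 hw v).differentiableAt (by simp)).hasFDerivAt
  refine (h.comp v (hasFDerivAt_prodMk_left v w)).congr_of_eventuallyEq ?_
  exact Eventually.of_forall fun v' => hC.So_eq h0 hw v'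

theorem SobolevBound.hasFDerivAt_So_right {w : H2 Ω} (hw : (hC.op h0 w).IsInvertible)
    (v : Hneg1 Ω) : HasFDerivAt (fun w' : H2 Ω => So Ω v w')
      ((fderiv ℝ (hC.sol h0) (v, w)).comp (ContinuousLinearMap.inr ℝ _ _)) w := by
  have h := ((hC.contDiffAt_sol h0 hw v).differentiableAt (by simp)).hasFDerivAt
  refine (h.comp w (hasFDerivAt_prodMk_right v w)).congr_of_eventuallyEq ?_
  -- The two maps are known to agree only where A(w') is invertible; openness of that set suffices
  -- for the derivative.
  filter_upwards [hC.eventually_isInvertible h0 hw] with w' hw'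
  exact hC.So_eq h0 hw' v

theorem SobolevBound.continuousAt_fderiv_sol {w : H2 Ω} (hw : (hC.op h0 w).IsInvertible)
    (v : Hneg1 Ω) : ContinuousAt (fderiv ℝ (hC.sol h0)) (v, w) :=
  (hC.contDiffAt_sol h0 hw v).continuousAt_fderiv (by simp)

/-- Partial derivatives are restrictions of the total derivative of a smooth map to one factor,
hence jointly continuous in (v, w). -/
theorem SobolevBound.continuousOn_DvSo : ContinuousOn (fun p : Hneg1 Ω × H2 Ω => DvSo Ω p.1 p.2)
    {p | (hC.op h0 p.2).IsInvertible} := by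
  have h : ContinuousOn (fun p : Hneg1 Ω × H2 Ω =>
      (fderiv ℝ (hC.sol h0) p).comp (ContinuousLinearMap.inl ℝ _ _))
      {p | (hC.op h0 p.2).IsInvertible} := fun p hp =>
    ((hC.continuousAt_fderiv_sol h0 hp p.1).clm_comp continuousAt_const).continuousWithinAt
  exact h.congr fun p hp => (hC.hasFDerivAt_So_left h0 hp p.1).fderiv

theorem SobolevBound.continuousOn_DwSo : ContinuousOn (fun p : Hneg1 Ω × H2 Ω => DwSo Ω p.1 p.2)
    {p | (hC.op h0 p.2).IsInvertible} := by
  have h : ContinuousOn (fun p : Hneg1 Ω × H2 Ω =>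
      (fderiv ℝ (hC.sol h0) p).comp (ContinuousLinearMap.inr ℝ _ _))
      {p | (hC.op h0 p.2).IsInvertible} := fun p hp =>
    ((hC.continuousAt_fderiv_sol h0 hp p.1).clm_comp continuousAt_const).continuousWithinAt
  exact h.congr fun p hp => (hC.hasFDerivAt_So_right h0 hp p.1).fderiv

end SolutionOperator

/-! ### From continuity to uniform continuity in time -/

section UniformContinuity

theorem tendsto_iSup_enorm_sub {X Y G : Type*} [NormedAddCommGroup X] [NormedSpace ℝ X]
    [NormedAddCommGroup Y] [NormedSpace ℝ Y] [NormedAddCommGroup G]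
    {D : X → Y → G} {S : Set (X × Y)} (hD : ContinuousOn (fun p : X × Y => D p.1 p.2) S)
    {T : ℝ} {v : ℝ → X} {w : ℝ → Y} (hv : ContinuousOn v (Icc 0 T))
    (hw : ContinuousOn w (Icc 0 T))
    (hS : ∀ t ∈ Icc 0 T, ∀ s ∈ Icc 0 T, ∀ τ ∈ Icc (0 : ℝ) 1,
      (v t + τ • (v s - v t), w t + τ • (w s - w t)) ∈ S) :
    Tendsto (fun h : ℝ => ⨆ (t : ℝ) (_ : t ∈ Icc 0 T) (_ : t + h ∈ Icc 0 T) (τ : ℝ)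
      (_ : τ ∈ Icc (0 : ℝ) 1), ‖D (v t + τ • (v (t + h) - v t)) (w t + τ • (w (t + h) - w t))
        - D (v t) (w t)‖ₑ) (𝓝 0) (𝓝 0) := by
  set q : ℝ × ℝ × ℝ → X × Y := fun z =>
    (v z.1 + z.2.2 • (v z.2.1 - v z.1), w z.1 + z.2.2 • (w z.2.1 - w z.1)) with hq
  set K : Set (ℝ × ℝ × ℝ) := Icc 0 T ×ˢ (Icc 0 T ×ˢ Icc 0 1) with hK
  have hKc : IsCompact K := isCompact_Icc.prod (isCompact_Icc.prod isCompact_Icc)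
  have h1 : MapsTo (fun z : ℝ × ℝ × ℝ => z.1) K (Icc 0 T) := fun z hz => hz.1
  have h2 : MapsTo (fun z : ℝ × ℝ × ℝ => z.2.1) K (Icc 0 T) := fun z hz => hz.2.1
  have hv1 : ContinuousOn (fun z : ℝ × ℝ × ℝ => v z.1) K := hv.comp (by fun_prop) h1
  have hv2 : ContinuousOn (fun z : ℝ × ℝ × ℝ => v z.2.1) K := hv.comp (by fun_prop) h2
  have hw1 : ContinuousOn (fun z : ℝ × ℝ × ℝ => w z.1) K := hw.comp (by fun_prop) h1
  have hw2 : ContinuousOn (fun z : ℝ × ℝ × ℝ => w z.2.1) K := hw.comp (by fun_prop) h2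
  have hqc : ContinuousOn q K := by fun_prop
  have hqS : MapsTo q K S := fun z hz => hS _ hz.1 _ hz.2.1 _ hz.2.2
  have hu := hKc.uniformContinuousOn_of_continuous (hD.comp hqc hqS)
  rw [EMetric.uniformContinuousOn_iff] at hu
  rw [ENNReal.tendsto_nhds_zero]
  intro ε hε
  obtain ⟨δ, hδ, hu⟩ := hu ε hε
  filter_upwards [Metric.eball_mem_nhds (0 : ℝ) hδ] with h hh
  refine iSup_le fun t => iSup_le fun ht => iSup_le fun hth => iSup_le fun τ => iSup_le fun hτ => ?_
  have hz : edist ((t, t + h, τ) : ℝ × ℝ × ℝ) (t, t, τ) < δ := by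
    rw [Metric.mem_eball, edist_eq_enorm_sub, sub_zero] at hh
    rw [Prod.edist_eq, Prod.edist_eq, edist_self, edist_self, edist_eq_enorm_sub,
      add_sub_cancel_left]
    simpa using hh
  -- At (t, t, τ) the increments vanish, so `q` returns (v t, w t); the two parameter points are |h|
  -- apart whatever t and τ are.
  have := hu (a := (t, t + h, τ)) ⟨ht, hth, hτ⟩ (b := (t, t, τ)) ⟨ht, ht, hτ⟩ hz
  rw [edist_eq_enorm_sub] at this
  simpa [hq] using this.le

end UniformContinuity

/-- Unique solvability, differentiability of the solution operator and uniform continuity of its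
partial derivatives, given the Sobolev embedding. -/
theorem solutionOperator_of_sobolevBound {n : ℕ} (hn : 0 < n) {Ω : Set (E n)} (hΩ : MeasurableSet Ω)
    (hΩb : Bornology.IsBounded Ω) {C : ℝ} (hC : SobolevBound Ω C) (h0 : 0 < C) (w₀ : H2 Ω) (κ : ℝ)
    (hκ : κ = essInf (H2.fn w₀) (volume.restrict Ω)) (hκ0 : 0 < κ) (r : ℝ)
    (hr : r < κ / (2 * C)) :
    (∀ (v : Hneg1 Ω), ∀ w ∈ Metric.closedBall w₀ r,
      (∃! u : H10 Ω, IsWeakSolution Ω v w u) ∧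
      (∀ᶠ w' in 𝓝 w, ∀ v' : Hneg1 Ω, ∃! u : H10 Ω, IsWeakSolution Ω v' w' u) ∧
      DifferentiableAt ℝ (fun v' : Hneg1 Ω => So Ω v' w) v ∧
      DifferentiableAt ℝ (fun w' : H2 Ω => So Ω v w') w) ∧
    ∀ (T : ℝ), 0 < T → ∀ (v : ℝ → Hneg1 Ω) (w : ℝ → H2 Ω),
      ContinuousOn v (Icc 0 T) → ContinuousOn w (Icc 0 T) →
      (∀ t ∈ Icc 0 T, w t ∈ Metric.closedBall w₀ r) →
      Tendsto (alpha1 Ω T v w) (𝓝 0) (𝓝 0) ∧ Tendsto (alpha2 Ω T v w) (𝓝 0) (𝓝 0) := by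
  have hinv (w : H2 Ω) (hw : w ∈ Metric.closedBall w₀ r) : (hC.op h0.le w).IsInvertible :=
    hC.op_isInvertible_of_mem_closedBall hn hΩ hΩb h0 hκ hκ0 hr hw
  refine ⟨fun v w hw => ⟨hC.existsUnique h0.le (hinv w hw) v, ?_,
    (hC.hasFDerivAt_So_left h0.le (hinv w hw) v).differentiableAt,
    (hC.hasFDerivAt_So_right h0.le (hinv w hw) v).differentiableAt⟩, ?_⟩
  · filter_upwards [hC.eventually_isInvertible h0.le (hinv w hw)] with w' hw' v'
    exact hC.existsUnique h0.le hw' v'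
  · intro T _ v w hv hw hwb
    have hS : ∀ t ∈ Icc 0 T, ∀ s ∈ Icc 0 T, ∀ τ ∈ Icc (0 : ℝ) 1,
        (v t + τ • (v s - v t), w t + τ • (w s - w t)) ∈
          {p : Hneg1 Ω × H2 Ω | (hC.op h0.le p.2).IsInvertible} := fun t ht s hs τ hτ =>
      hinv _ ((convex_closedBall w₀ r).add_smul_sub_mem (hwb t ht) (hwb s hs) hτ)
    exact ⟨tendsto_iSup_enorm_sub (D := DvSo Ω) (hC.continuousOn_DvSo h0.le) hv hw hS,
      tendsto_iSup_enorm_sub (D := DwSo Ω) (hC.continuousOn_DwSo h0.le) hv hw hS⟩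

/-! ### Mollification and weak derivatives -/

section Mollification
variable {n : ℕ} {Ω : Set (E n)}

open scoped Convolution

/-- The mollification of an `L²(Ω)` function, extended by zero, with a normalized bump function. -/
def moll (φ : ContDiffBump (0 : E n)) (g : L2 Ω) : E n → ℝ :=
  φ.normed volume ⋆[ContinuousLinearMap.lsmul ℝ ℝ, volume] Ω.indicator g

theorem integrable_indicator (hΩ : MeasurableSet Ω) (hb : Bornology.IsBounded Ω) (g : L2 Ω) :
    Integrable (Ω.indicator g) (volume : Measure (E n)) := by
  have : IsFiniteMeasure (volume.restrict Ω) := ⟨by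
    rw [Measure.restrict_apply_univ]; exact hb.measure_lt_top⟩
  rw [integrable_indicator_iff hΩ]
  exact (Lp.memLp g).integrable (by norm_num)

theorem moll_eq_integral (hΩ : MeasurableSet Ω) (φ : ContDiffBump (0 : E n)) (g : L2 Ω) (x : E n) :
    moll φ g x = ∫ y in Ω, g y * φ.normed volume (x - y) := by
  rw [moll, convolution_eq_swap, ← integral_indicator hΩ]
  refine integral_congr_ae (Eventually.of_forall fun y => ?_)
  by_cases hy : y ∈ Ω <;> simp [hy, mul_comm]

theorem contDiff_moll (hΩ : MeasurableSet Ω) (hb : Bornology.IsBounded Ω)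
    (φ : ContDiffBump (0 : E n)) (g : L2 Ω) : ContDiff ℝ 1 (moll φ g) :=
  φ.hasCompactSupport_normed.contDiff_convolution_left _ φ.contDiff_normed
    (integrable_indicator hΩ hb g).locallyIntegrable

/-- When the ball lies in Ω, y ↦ η(x - y) is a test function. Its y-derivative is minus the
derivative of η at x - y, which cancels the sign in the definition of the weak derivative. -/
theorem fderiv_moll (hΩ : MeasurableSet Ω) (hb : Bornology.IsBounded Ω)
    (φ : ContDiffBump (0 : E n)) {i : Fin n} {f g : L2 Ω} (h : HasWeakPartial Ω i f g) {x : E n}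
    (hx : Metric.closedBall x φ.rOut ⊆ Ω) :
    fderiv ℝ (moll φ f) x (EuclideanSpace.single i 1) = moll φ g x := by
  set η : E n → ℝ := φ.normed volume with hη
  have hηs : ContDiff ℝ ∞ η := φ.contDiff_normed
  have ht : IsTest Ω fun y => η (x - y) := by
    have hsub : tsupport (fun y => η (x - y)) ⊆ Metric.closedBall x φ.rOut := by
      refine closure_minimal (fun y hy => ?_) Metric.isClosed_closedBall
      have : x - y ∈ Function.support η := hy
      rw [hη, φ.support_normed_eq, mem_ball_zero_iff] at this
      rw [mem_closedBall_iff_norm']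
      exact this.le
    exact ⟨hηs.comp (contDiff_const.sub contDiff_id),
      (isCompact_closedBall x φ.rOut).of_isClosed_subset (isClosed_tsupport _) hsub,
      hsub.trans hx⟩
  have hpd (y : E n) : pderiv i (fun y => η (x - y)) y =
      -fderiv ℝ η (x - y) (EuclideanSpace.single i 1) := by
    have h1 : HasFDerivAt (fun y => η (x - y)) _ y :=
      (hηs.differentiable (by simp) (x - y)).hasFDerivAt.comp y
        ((hasFDerivAt_const x y).sub (hasFDerivAt_id y))
    rw [pderiv, h1.fderiv]
    simp
  have hd := (φ.hasCompactSupport_normed (μ := volume)).hasFDerivAt_convolution_right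
    (ContinuousLinearMap.lsmul ℝ ℝ).flip (integrable_indicator hΩ hb f).locallyIntegrable
    φ.contDiff_normed x
  rw [convolution_flip] at hd
  have hd' : fderiv ℝ (moll φ f) x = _ := hd.fderiv
  rw [hd', convolution_precompR_apply]
  · rw [moll_eq_integral hΩ, ← neg_inj, ← h _ ht, ← integral_indicator hΩ]
    rw [convolution, ← integral_neg]
    refine integral_congr_ae (Eventually.of_forall fun y => ?_)
    by_cases hy : y ∈ Ω
    · simp only [indicator_of_mem hy, hpd]
      simp [mul_comm, hη]
    · simp [hy]
  · exact (integrable_indicator hΩ hb f).locallyIntegrable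
  · exact φ.hasCompactSupport_normed.fderiv ℝ
  · exact hηs.continuous_fderiv (by simp)

/-- Young's inequality in L¹: Tonelli and total mass one of the kernel. The bound does not depend on
the mollifier. -/
theorem lintegral_enorm_moll_le (hΩ : MeasurableSet Ω) (hb : Bornology.IsBounded Ω)
    (φ : ContDiffBump (0 : E n)) (g : L2 Ω) :
    ∫⁻ x, ‖moll φ g x‖ₑ ≤ ∫⁻ x in Ω, ‖g x‖ₑ := by
  have hη : Continuous (φ.normed (volume : Measure (E n))) :=
    (φ.contDiff_normed (n := 0)).continuous
  have h1 : ∫⁻ z, ‖φ.normed (volume : Measure (E n)) z‖ₑ = 1 := by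
    have h := φ.integral_normed (μ := volume)
    have h2 := ofReal_integral_eq_lintegral_ofReal (μ := volume) φ.integrable_normed
      (Eventually.of_forall φ.nonneg_normed)
    rw [h, ENNReal.ofReal_one] at h2
    rw [h2]
    exact lintegral_congr fun z => Real.enorm_of_nonneg (φ.nonneg_normed z)
  have hm : AEMeasurable (Ω.indicator g) (volume : Measure (E n)) :=
    (integrable_indicator hΩ hb g).aestronglyMeasurable.aemeasurable
  calc ∫⁻ x, ‖moll φ g x‖ₑ
      ≤ ∫⁻ x, ∫⁻ y, ‖φ.normed volume (x - y)‖ₑ * ‖Ω.indicator g y‖ₑ := by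
        refine lintegral_mono fun x => ?_
        rw [moll, convolution_eq_swap]
        refine (enorm_integral_le_lintegral_enorm _).trans_eq ?_
        simp [enorm_mul]
    _ = ∫⁻ y, ∫⁻ x, ‖φ.normed volume (x - y)‖ₑ * ‖Ω.indicator g y‖ₑ := by
        refine lintegral_lintegral_swap ?_
        have h2 : Continuous fun z : E n × E n => φ.normed volume (z.1 - z.2) := by fun_prop
        exact h2.enorm.measurable.aemeasurable.mul hm.enorm.comp_snd
    _ = ∫⁻ y, ‖Ω.indicator g y‖ₑ := by
        refine lintegral_congr fun y => ?_
        have h2 : Continuous fun x => φ.normed volume (x - y) := by fun_prop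
        rw [lintegral_mul_const _ h2.enorm.measurable,
          lintegral_sub_right_eq_self (fun z => ‖φ.normed volume z‖ₑ) y, h1, one_mul]
    _ = ∫⁻ x in Ω, ‖g x‖ₑ := by
        rw [← lintegral_indicator hΩ]
        refine lintegral_congr fun y => ?_
        rw [enorm_indicator_eq_indicator_enorm]

theorem lintegral_enorm_le (g : L2 Ω) :
    ∫⁻ x in Ω, ‖g x‖ₑ ≤ volume Ω ^ (1 / 2 : ℝ) * ‖g‖ₑ := by
  have h := eLpNorm_le_eLpNorm_mul_rpow_measure_univ (μ := volume.restrict Ω) (p := 1) (q := 2)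
    (by norm_num) (Lp.aestronglyMeasurable g)
  rw [eLpNorm_one_eq_lintegral_enorm, Measure.restrict_apply_univ, ← Lp.enorm_def, mul_comm] at h
  refine h.trans_eq ?_
  norm_num

theorem ae_tendsto_moll (hΩ : MeasurableSet Ω) (hb : Bornology.IsBounded Ω) {φ : ℕ → ContDiffBump (0 : E n)}
    (h0 : Tendsto (fun k => (φ k).rOut) atTop (𝓝 0)) (h1 : ∀ k, (φ k).rOut ≤ 2 * (φ k).rIn)
    (g : L2 Ω) : ∀ᵐ x ∂volume.restrict Ω, Tendsto (fun k => moll (φ k) g x) atTop (𝓝 (g x)) := by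
  have h := ContDiffBump.ae_convolution_tendsto_right_of_locallyIntegrable (μ := volume) h0
    (Eventually.of_forall h1) (integrable_indicator hΩ hb g).locallyIntegrable
  filter_upwards [ae_restrict_of_ae h, ae_restrict_mem hΩ] with x hx hxΩ
  rwa [indicator_of_mem hxΩ] at hx

end Mollification

/-! ### Pointwise bounds by integrals along a segment -/

section Segment

/-- Integrate the derivative of (1 - s) f(x + s a) over [0, 1]: the weight removes the far endpoint
and leaves -f(x). -/
theorem enorm_le_lintegral_segment {V : Type*} [NormedAddCommGroup V] [NormedSpace ℝ V] {f : V → ℝ}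
    (hf : ContDiff ℝ 1 f) (x a : V) :
    ‖f x‖ₑ ≤ ∫⁻ s in Icc (0 : ℝ) 1, (‖f (x + s • a)‖ₑ + ‖fderiv ℝ f (x + s • a) a‖ₑ) := by
  have hl (s : ℝ) : HasDerivAt (fun s : ℝ => x + s • a) a s := by
    simpa using ((hasDerivAt_id s).smul_const a).const_add x
  have hc : Continuous fun s : ℝ => x + s • a := by fun_prop
  have hfd (s : ℝ) : HasDerivAt (fun s : ℝ => f (x + s • a)) (fderiv ℝ f (x + s • a) a) s :=
    (hf.differentiable (by simp) _).hasFDerivAt.comp_hasDerivAt s (hl s)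
  have hF (s : ℝ) : HasDerivAt (fun s : ℝ => (1 - s) * f (x + s • a))
      (-1 * f (x + s • a) + (1 - s) * fderiv ℝ f (x + s • a) a) s :=
    ((hasDerivAt_id s).const_sub 1).mul (hfd s)
  have hcf : Continuous fun s : ℝ => f (x + s • a) := hf.continuous.comp hc
  have hcd : Continuous fun s : ℝ => fderiv ℝ f (x + s • a) a :=
    ((hf.continuous_fderiv (by simp)).comp hc).clm_apply continuous_const
  have hI := intervalIntegral.integral_eq_sub_of_hasDerivAt (a := 0) (b := 1) (fun s _ => hF s)
    (Continuous.intervalIntegrable (by fun_prop) _ _)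
  rw [intervalIntegral.integral_of_le zero_le_one, ← integral_Icc_eq_integral_Ioc] at hI
  have : ‖f x‖ₑ = ‖∫ s in Icc (0 : ℝ) 1,
      (-1 * f (x + s • a) + (1 - s) * fderiv ℝ f (x + s • a) a)‖ₑ := by
    rw [hI]
    simp
  rw [this]
  refine (enorm_integral_le_lintegral_enorm _).trans (setLIntegral_mono' measurableSet_Icc ?_)
  intro s hs
  refine (enorm_add_le _ _).trans ?_
  gcongr
  · simp
  · rw [enorm_mul]
    refine mul_le_of_le_one_left' ?_
    rw [Real.enorm_of_nonneg (by linarith [hs.2])]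
    simpa using hs.1

variable {n : ℕ} {Ω : Set (E n)}

theorem enorm_moll_le_lintegral_segment (hΩ : MeasurableSet Ω) (hb : Bornology.IsBounded Ω)
    (φ : ContDiffBump (0 : E n)) {f : L2 Ω} {g : Fin n → L2 Ω}
    (h : ∀ i, HasWeakPartial Ω i f (g i)) {x a : E n}
    (hx : ∀ s ∈ Icc (0 : ℝ) 1, Metric.closedBall (x + s • a) φ.rOut ⊆ Ω) :
    ‖moll φ f x‖ₑ ≤ (1 + ‖a‖ₑ) * ∫⁻ s in Icc (0 : ℝ) 1,
      (‖moll φ f (x + s • a)‖ₑ + ∑ i, ‖moll φ (g i) (x + s • a)‖ₑ) := by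
  refine (enorm_le_lintegral_segment (contDiff_moll hΩ hb φ f) x a).trans ?_
  rw [← lintegral_const_mul' _ _ (by finiteness)]
  refine setLIntegral_mono' measurableSet_Icc fun s hs => ?_
  rw [mul_add]
  gcongr
  · exact le_mul_of_one_le_left' (by simp)
  · have ha : a = ∑ i, a i • EuclideanSpace.single i (1 : ℝ) := by
      ext j
      simp [Finset.sum_apply, Pi.single_apply]
    have h1 : fderiv ℝ (moll φ f) (x + s • a) a = ∑ i, a i * moll φ (g i) (x + s • a) := by
      conv_lhs => rw [ha, map_sum]
      rw [← ha]
      exact Finset.sum_congr rfl fun i _ => by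
        rw [map_smul, fderiv_moll hΩ hb φ (h i) (hx s hs), smul_eq_mul]
    rw [h1, Finset.mul_sum]
    refine (enorm_sum_le _ _).trans (Finset.sum_le_sum fun i _ => ?_)
    rw [enorm_mul]
    gcongr
    refine le_trans ?_ le_add_self
    rw [enorm_le_iff_norm_le]
    exact PiLp.norm_apply_le a i

end Segment

/-! ### Parallelograms inside a smooth domain -/

section Geometry
variable {n : ℕ} {Ω : Set (E n)}

/-- Near `x₀`, the set `Ω` contains a small parallelogram with sides parallel to `a` and `b`
attached to each of its points. -/
def HasLocalParallelograms (Ω : Set (E n)) (x₀ a b : E n) : Prop :=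
  ∃ δ : ℝ, 0 < δ ∧ ∃ V ∈ 𝓝 x₀, ∀ x ∈ V ∩ Ω, ∀ s ∈ Icc (0 : ℝ) 1, ∀ t ∈ Icc (0 : ℝ) 1,
    x + (s • δ • a + t • δ • b) ∈ Ω

theorem exists_norm_parallelogram_lt (a b : E n) {η : ℝ} (hη : 0 < η) :
    ∃ δ : ℝ, 0 < δ ∧ ∀ s ∈ Icc (0 : ℝ) 1, ∀ t ∈ Icc (0 : ℝ) 1, ‖s • δ • a + t • δ • b‖ < η := by
  refine ⟨η / (‖a‖ + ‖b‖ + 1), by positivity, fun s hs t ht => ?_⟩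
  have hδ : 0 < η / (‖a‖ + ‖b‖ + 1) := by positivity
  set δ := η / (‖a‖ + ‖b‖ + 1) with hd
  have h1 : δ * (‖a‖ + ‖b‖ + 1) = η := div_mul_cancel₀ _ (by positivity)
  have h2 : ‖s • δ • a‖ ≤ δ * ‖a‖ := by
    rw [norm_smul, norm_smul, Real.norm_of_nonneg hs.1, Real.norm_of_nonneg hδ.le]
    exact mul_le_of_le_one_left (by positivity) hs.2
  have h3 : ‖t • δ • b‖ ≤ δ * ‖b‖ := by
    rw [norm_smul, norm_smul, Real.norm_of_nonneg ht.1, Real.norm_of_nonneg hδ.le]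
    exact mul_le_of_le_one_left (by positivity) ht.2
  linarith [norm_add_le (s • δ • a) (t • δ • b)]

theorem hasLocalParallelograms_of_mem (hΩ : IsOpen Ω) {x₀ : E n} (hx₀ : x₀ ∈ Ω) (a b : E n) :
    HasLocalParallelograms Ω x₀ a b := by
  obtain ⟨η, hη, hb⟩ := Metric.isOpen_iff.1 hΩ x₀ hx₀
  obtain ⟨δ, hδ, h⟩ := exists_norm_parallelogram_lt a b (half_pos hη)
  refine ⟨δ, hδ, Metric.ball x₀ (η / 2), Metric.ball_mem_nhds _ (half_pos hη),
    fun x hx s hs t ht => hb ?_⟩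
  have h1 := h s hs t ht
  have h2 := mem_ball_iff_norm.1 hx.1
  rw [mem_ball_iff_norm, add_sub_right_comm]
  linarith [norm_add_le (x - x₀) (s • δ • a + t • δ • b)]

/-- By continuity the derivatives of ρ along a and b stay negative on a ball around x₀. The mean
value theorem then shows that ρ does not increase from x to a point of the parallelogram, so ρ < 0
persists. -/
theorem hasLocalParallelograms_of_fderiv_neg {x₀ a b : E n} {U : Set (E n)} {ρ : E n → ℝ}
    (hU : IsOpen U) (hx₀ : x₀ ∈ U) (hρ : ContDiff ℝ ∞ ρ) (hΩU : Ω ∩ U = {x | ρ x < 0} ∩ U)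
    (ha : fderiv ℝ ρ x₀ a < 0) (hb : fderiv ℝ ρ x₀ b < 0) : HasLocalParallelograms Ω x₀ a b := by
  have hc := hρ.continuous_fderiv (by simp)
  have hN : ∀ᶠ y in 𝓝 x₀, y ∈ U ∧ fderiv ℝ ρ y a < 0 ∧ fderiv ℝ ρ y b < 0 :=
    (hU.eventually_mem hx₀).and <|
      ((hc.clm_apply continuous_const).continuousAt.eventually_lt_const ha).and
      ((hc.clm_apply continuous_const).continuousAt.eventually_lt_const hb)
  obtain ⟨η, hη, hball⟩ := Metric.eventually_nhds_iff_ball.1 hN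
  obtain ⟨δ, hδ, h⟩ := exists_norm_parallelogram_lt a b (half_pos hη)
  refine ⟨δ, hδ, Metric.ball x₀ (η / 2), Metric.ball_mem_nhds _ (half_pos hη),
    fun x hx s hs t ht => ?_⟩
  have h1 := h s hs t ht
  have h2 := mem_ball_iff_norm.1 hx.1
  have hxb : x ∈ Metric.ball x₀ η := Metric.ball_subset_ball (by linarith) hx.1
  have hyb : x + (s • δ • a + t • δ • b) ∈ Metric.ball x₀ η := by
    rw [mem_ball_iff_norm, add_sub_right_comm]
    linarith [norm_add_le (x - x₀) (s • δ • a + t • δ • b)]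
  obtain ⟨z, hz, hzeq⟩ := domain_mvt (f := ρ) (f' := fderiv ℝ ρ) (s := Metric.ball x₀ η)
    (fun y _ => (hρ.differentiable (by simp) y).hasFDerivAt.hasFDerivWithinAt)
    (convex_ball x₀ η) hxb hyb
  obtain ⟨-, hza, hzb⟩ := hball z ((convex_ball x₀ η).segment_subset hxb hyb hz)
  have hρx : ρ x < 0 := ((Set.ext_iff.1 hΩU x).1 ⟨hx.2, (hball x hxb).1⟩).1
  have hle : fderiv ℝ ρ z (s • δ • a + t • δ • b) ≤ 0 := by
    simp only [map_add, map_smul, smul_eq_mul]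
    have e1 := mul_nonpos_of_nonneg_of_nonpos hs.1 (mul_nonpos_of_nonneg_of_nonpos hδ.le hza.le)
    have e2 := mul_nonpos_of_nonneg_of_nonpos ht.1 (mul_nonpos_of_nonneg_of_nonpos hδ.le hzb.le)
    linarith
  rw [add_sub_cancel_left] at hzeq
  refine ((Set.ext_iff.1 hΩU _).2 ⟨?_, (hball _ hyb).1⟩).1
  change ρ _ < 0
  linarith

theorem exists_functional_hasLocalParallelograms (hn : 0 < n) (hΩ : IsOpen Ω)
    (hs : HasSmoothBoundary Ω) {x₀ : E n} (hx₀ : x₀ ∈ closure Ω) :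
    ∃ ℓ : E n →L[ℝ] ℝ, ℓ ≠ 0 ∧ ∀ a b, ℓ a < 0 → ℓ b < 0 → HasLocalParallelograms Ω x₀ a b := by
  by_cases h : x₀ ∈ Ω
  · refine ⟨PiLp.proj (𝕜 := ℝ) 2 (fun _ : Fin n => ℝ) ⟨0, hn⟩, fun h0 => ?_,
      fun a b _ _ => hasLocalParallelograms_of_mem hΩ h a b⟩
    simpa using DFunLike.congr_fun h0 (EuclideanSpace.single ⟨0, hn⟩ (1 : ℝ))
  · obtain ⟨U, ρ, hU, hxU, hρ, hd, hΩU⟩ := hs x₀ (by rw [hΩ.frontier_eq]; exact ⟨hx₀, h⟩)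
    exact ⟨fderiv ℝ ρ x₀, hd, fun a b ha hb =>
      hasLocalParallelograms_of_fderiv_neg hU hxU hρ hΩU ha hb⟩

theorem exists_apply_neg {V : Type*} [AddCommGroup V] [Module ℝ V] [TopologicalSpace V]
    {ℓ : V →L[ℝ] ℝ} (h : ℓ ≠ 0) : ∃ a, ℓ a < 0 := by
  obtain ⟨a, ha⟩ := DFunLike.ne_iff.1 h
  rcases lt_or_gt_of_ne ha with ha | ha
  · exact ⟨a, ha⟩
  · exact ⟨-a, by simpa using ha⟩

theorem exists_pair_apply_neg {ℓ : E 2 →L[ℝ] ℝ} (h : ℓ ≠ 0) :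
    ∃ a b, ℓ a < 0 ∧ ℓ b < 0 ∧ ∀ s t : ℝ, s • a + t • b = 0 → s = 0 ∧ t = 0 := by
  set p := ℓ (EuclideanSpace.single 0 1) with hp
  set q := ℓ (EuclideanSpace.single 1 1) with hq
  have hl (x : E 2) : ℓ x = x 0 * p + x 1 * q := by
    have : x = x 0 • EuclideanSpace.single 0 (1 : ℝ) + x 1 • EuclideanSpace.single 1 (1 : ℝ) := by
      ext j
      fin_cases j <;> simp
    conv_lhs => rw [this]
    simp [hp, hq]
  have hpq : 0 < p ^ 2 + q ^ 2 := by
    by_contra hle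
    have h1 : p = 0 := by nlinarith [sq_nonneg p, sq_nonneg q]
    have h2 : q = 0 := by nlinarith [sq_nonneg p, sq_nonneg q]
    exact h (ContinuousLinearMap.ext fun x => by simp [hl, h1, h2])
  -- With g = (p, q) representing ℓ, these are -g plus and minus a quarter turn of g. They are
  -- orthogonal, and ℓ equals -|g|² on both.
  refine ⟨!₂[-p + q, -q - p], !₂[-p - q, -q + p], ?_, ?_, fun s t hst => ?_⟩
  · rw [hl]
    simp
    nlinarith
  · rw [hl]
    simp
    nlinarith
  · have h0 := congrArg (fun x : E 2 => x 0) hst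
    have h1 := congrArg (fun x : E 2 => x 1) hst
    simp at h0 h1
    have hs : s * (2 * (p ^ 2 + q ^ 2)) = 0 := by linear_combination (-p + q) * h0 + (-q - p) * h1
    have ht : t * (2 * (p ^ 2 + q ^ 2)) = 0 := by linear_combination (-p - q) * h0 + (-q + p) * h1
    have hne : 2 * (p ^ 2 + q ^ 2) ≠ 0 := by positivity
    exact ⟨(mul_eq_zero.1 hs).resolve_right hne, (mul_eq_zero.1 ht).resolve_right hne⟩

end Geometry

/-! ### The Sobolev embedding in dimensions one and two -/

section Embedding
variable {n : ℕ} {Ω : Set (E n)}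

/-- The first weak partial derivatives of an element of `H²(Ω)`. -/
def H2.grad (w : H2 Ω) (i : Fin n) : L2 Ω := (Subtype.val w).snd.fst i

/-- The second weak partial derivatives of an element of `H²(Ω)`. -/
def H2.hess (w : H2 Ω) (i j : Fin n) : L2 Ω := (Subtype.val w).snd.snd (i, j)

theorem H2.hasWeakPartial_fn (w : H2 Ω) (i : Fin n) : HasWeakPartial Ω i (H2.fn w) (H2.grad w i) :=
  w.property.1 i

theorem H2.hasWeakPartial_grad (w : H2 Ω) (i j : Fin n) :
    HasWeakPartial Ω j (H2.grad w i) (H2.hess w i j) :=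
  w.property.2 i j

theorem H2.norm_grad_le (w : H2 Ω) (i : Fin n) : ‖H2.grad w i‖ ≤ ‖w‖ :=
  (PiLp.norm_apply_le _ i).trans ((WithLp.norm_fst_le _ _).trans (WithLp.norm_snd_le _ _))

theorem H2.norm_hess_le (w : H2 Ω) (i j : Fin n) : ‖H2.hess w i j‖ ≤ ‖w‖ :=
  (PiLp.norm_apply_le _ (i, j)).trans ((WithLp.norm_snd_le _ _).trans (WithLp.norm_snd_le _ _))

/-- The sum of the absolute values of the mollified partial derivatives of order at most two. -/
def mollSum (φ : ContDiffBump (0 : E n)) (w : H2 Ω) (x : E n) : ℝ≥0∞ :=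
  ‖moll φ (H2.fn w) x‖ₑ + ∑ i, ‖moll φ (H2.grad w i) x‖ₑ
    + ∑ i, ∑ j, ‖moll φ (H2.hess w i j) x‖ₑ

theorem continuous_mollSum (hΩ : MeasurableSet Ω) (hb : Bornology.IsBounded Ω)
    (φ : ContDiffBump (0 : E n)) (w : H2 Ω) : Continuous (mollSum φ w) := by
  have h (g : L2 Ω) : Continuous fun x => ‖moll φ g x‖ₑ := (contDiff_moll hΩ hb φ g).continuous.enorm
  unfold mollSum
  exact ((h _).add (continuous_finsetSum _ fun i _ => h _)).add
    (continuous_finsetSum _ fun i _ => continuous_finsetSum _ fun j _ => h _)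

theorem lintegral_mollSum_le (hΩ : MeasurableSet Ω) (hb : Bornology.IsBounded Ω)
    (φ : ContDiffBump (0 : E n)) (w : H2 Ω) :
    ∫⁻ x, mollSum φ w x ≤ (1 + n + n * n) * (volume Ω ^ (1 / 2 : ℝ) * ‖w‖ₑ) := by
  have hm (g : L2 Ω) : Measurable fun x => ‖moll φ g x‖ₑ :=
    (contDiff_moll hΩ hb φ g).continuous.enorm.measurable
  have h (g : L2 Ω) (hg : ‖g‖ ≤ ‖w‖) :
      ∫⁻ x, ‖moll φ g x‖ₑ ≤ volume Ω ^ (1 / 2 : ℝ) * ‖w‖ₑ := by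
    refine (lintegral_enorm_moll_le hΩ hb φ g).trans ((lintegral_enorm_le g).trans ?_)
    gcongr
    exact enorm_le_iff_norm_le.2 hg
  unfold mollSum
  rw [lintegral_add_left (by fun_prop), lintegral_add_left (by fun_prop),
    lintegral_finsetSum _ (by fun_prop), lintegral_finsetSum _ (by fun_prop)]
  simp only [lintegral_finsetSum _ fun j _ => hm _]
  rw [add_mul, add_mul, one_mul]
  gcongr
  · exact h _ (H2.norm_fn_le w)
  · refine (Finset.sum_le_sum fun i _ => h _ (H2.norm_grad_le w i)).trans_eq ?_
    simp
  · refine (Finset.sum_le_sum fun i _ => Finset.sum_le_sum fun j _ =>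
      h _ (H2.norm_hess_le w i j)).trans_eq ?_
    simp [mul_assoc]

/-- Uniqueness of Haar measure supplies the Jacobian constant; by translation invariance it is
independent of x, which makes the local bound uniform. -/
theorem exists_lintegral_comp_add_equiv {F : Type*} [NormedAddCommGroup F] [NormedSpace ℝ F]
    [MeasureSpace F] [BorelSpace F] [(volume : Measure F).IsAddHaarMeasure] (e : F ≃L[ℝ] E n) :
    ∃ c : NNReal, ∀ (x : E n) (Q : E n → ℝ≥0∞), Measurable Q →
      ∫⁻ z, Q (x + e z) = c * ∫⁻ y, Q y := by
  have hm : ((volume : Measure F).map e).IsAddHaarMeasure := e.isAddHaarMeasure_map volume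
  refine ⟨Measure.addHaarScalarFactor ((volume : Measure F).map e) volume, fun x Q hQ => ?_⟩
  have h := Measure.isAddLeftInvariant_eq_smul ((volume : Measure F).map e) volume
  have h1 : ∫⁻ z, Q (x + e z) = ∫⁻ y, Q (x + y) ∂((volume : Measure F).map e) :=
    (lintegral_map (hQ.comp (measurable_const_add x)) e.continuous.measurable).symm
  rw [h1, lintegral_add_left_eq_self (μ := (volume : Measure F).map e) Q x]
  conv_lhs => rw [h]
  rw [lintegral_smul_measure]
  rfl

/-- A pointwise bound for mollifications by integrals over parallelepipeds gives a local `L^∞`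
bound. -/
theorem exists_local_bound (hΩ : IsOpen Ω) (hb : Bornology.IsBounded Ω) {F : Type*}
    [NormedAddCommGroup F] [NormedSpace ℝ F] [MeasureSpace F] [BorelSpace F]
    [(volume : Measure F).IsAddHaarMeasure] (e : F ≃L[ℝ] E n) {Q : Set F} (hQ : IsCompact Q)
    {V : Set (E n)} (hV : ∀ x ∈ V ∩ Ω, ∀ z ∈ Q, x + e z ∈ Ω) {K : ℝ≥0∞} (hK : K ≠ ⊤)
    (hpt : ∀ (w : H2 Ω) (φ : ContDiffBump (0 : E n)) (x : E n),
      (∀ z ∈ Q, Metric.closedBall (x + e z) φ.rOut ⊆ Ω) →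
        ‖moll φ (H2.fn w) x‖ₑ ≤ K * ∫⁻ z, mollSum φ w (x + e z)) :
    ∃ C : ℝ, ∀ w : H2 Ω, ∀ᵐ x ∂volume.restrict Ω, x ∈ V → |H2.fn w x| ≤ C * ‖w‖ := by
  obtain ⟨c, hc⟩ := exists_lintegral_comp_add_equiv e
  obtain ⟨M, hM⟩ : ∃ M : ℝ≥0∞, M = K * (c * ((1 + n + n * n) * volume Ω ^ (1 / 2 : ℝ))) := ⟨_, rfl⟩
  have hMtop : M ≠ ⊤ := by
    have := hb.measure_lt_top (μ := volume)
    rw [hM]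
    finiteness
  -- The outer radius is twice the inner one: a.e. convergence of mollifications needs this ratio
  -- bounded.
  set φ : ℕ → ContDiffBump (0 : E n) := fun k =>
    ⟨1 / ((k : ℝ) + 1), 2 * (1 / ((k : ℝ) + 1)), by positivity, by
      have : 0 < 1 / ((k : ℝ) + 1) := by positivity
      linarith⟩ with hφ
  have hφ0 : Tendsto (fun k => (φ k).rOut) atTop (𝓝 0) := by
    simpa [hφ] using (tendsto_one_div_add_atTop_nhds_zero_nat (𝕜 := ℝ)).const_mul 2
  refine ⟨M.toReal, fun w => ?_⟩
  filter_upwards [ae_tendsto_moll hΩ.measurableSet hb hφ0 (fun k => le_rfl) (H2.fn w),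
    ae_restrict_mem hΩ.measurableSet] with x hx hxΩ hxV
  have hP : IsCompact ((fun z => x + e z) '' Q) := hQ.image (by fun_prop)
  -- The attached cell is compact in the open set Ω, so the mollification balls along it lie in Ω
  -- for all large k. How large depends on x, but the bound does not.
  obtain ⟨δ, hδ, hδΩ⟩ := hP.exists_cthickening_subset_open hΩ (by
    rintro _ ⟨z, hz, rfl⟩
    exact hV x ⟨hxV, hxΩ⟩ z hz)
  have hle : ∀ᶠ k in atTop, ‖moll (φ k) (H2.fn w) x‖ₑ ≤ M * ‖w‖ₑ := by
    filter_upwards [hφ0.eventually_lt_const hδ] with k hk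
    have hsub : ∀ z ∈ Q, Metric.closedBall (x + e z) (φ k).rOut ⊆ Ω := fun z hz =>
      (Metric.closedBall_subset_closedBall hk.le).trans
        ((Metric.closedBall_subset_cthickening (mem_image_of_mem (fun z => x + e z) hz) δ).trans hδΩ)
    refine (hpt w (φ k) x hsub).trans ?_
    rw [hc x _ (continuous_mollSum hΩ.measurableSet hb _ w).measurable]
    calc K * (c * ∫⁻ y, mollSum (φ k) w y)
        ≤ K * (c * ((1 + n + n * n) * (volume Ω ^ (1 / 2 : ℝ) * ‖w‖ₑ))) :=
          mul_le_mul_right (mul_le_mul_right (lintegral_mollSum_le hΩ.measurableSet hb _ w) _) _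
      _ = M * ‖w‖ₑ := by rw [hM]; ring
  have hlim := le_of_tendsto hx.enorm hle
  have := ENNReal.toReal_mono (by finiteness) hlim
  simpa using this

theorem exists_bound_near_of_dim_one (Ω : Set (E 1)) (hΩ : IsOpen Ω) (hb : Bornology.IsBounded Ω)
    (hs : HasSmoothBoundary Ω) (x₀ : E 1) (hx₀ : x₀ ∈ closure Ω) :
    ∃ V ∈ 𝓝 x₀, ∃ C : ℝ, ∀ w : H2 Ω, ∀ᵐ x ∂volume.restrict Ω, x ∈ V → |H2.fn w x| ≤ C * ‖w‖ := by
  obtain ⟨ℓ, hℓ, h⟩ := exists_functional_hasLocalParallelograms one_pos hΩ hs hx₀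
  obtain ⟨a, ha⟩ := exists_apply_neg hℓ
  -- In dimension one the parallelogram degenerates: both sides are a, and only t = 0 is used.
  obtain ⟨δ, hδ, V, hV, hpar⟩ := h a a ha ha
  have ha0 : a ≠ 0 := by
    rintro rfl
    simp at ha
  set e : ℝ ≃L[ℝ] E 1 := (LinearEquiv.ofInjectiveOfFinrankEq
    (LinearMap.toSpanSingleton ℝ (E 1) (δ • a)) (by
      intro s t hst
      exact smul_left_injective ℝ (smul_ne_zero hδ.ne' ha0) hst) (by simp)).toContinuousLinearEquiv with he
  have hez (s : ℝ) : e s = s • δ • a := rfl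
  refine ⟨V, hV, exists_local_bound hΩ hb e (isCompact_Icc (a := (0 : ℝ)) (b := 1))
    (fun x hx s hs => ?_) (K := 1 + ‖δ • a‖ₑ) (by finiteness) fun w φ x hx => ?_⟩
  · simpa [hez] using hpar x hx s hs 0 (by simp)
  · refine (enorm_moll_le_lintegral_segment hΩ.measurableSet hb φ (H2.hasWeakPartial_fn w) hx).trans ?_
    refine mul_le_mul_right ?_ _
    refine (setLIntegral_le_lintegral _ _).trans (lintegral_mono fun s => ?_)
    exact le_self_add

theorem exists_bound_near_of_dim_two (Ω : Set (E 2)) (hΩ : IsOpen Ω) (hb : Bornology.IsBounded Ω)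
    (hs : HasSmoothBoundary Ω) (x₀ : E 2) (hx₀ : x₀ ∈ closure Ω) :
    ∃ V ∈ 𝓝 x₀, ∃ C : ℝ, ∀ w : H2 Ω, ∀ᵐ x ∂volume.restrict Ω, x ∈ V → |H2.fn w x| ≤ C * ‖w‖ := by
  obtain ⟨ℓ, hℓ, h⟩ := exists_functional_hasLocalParallelograms two_pos hΩ hs hx₀
  obtain ⟨a, b, ha, hb', hab⟩ := exists_pair_apply_neg hℓ
  obtain ⟨δ, hδ, V, hV, hpar⟩ := h a b ha hb'
  set L : ℝ × ℝ →ₗ[ℝ] E 2 := (LinearMap.toSpanSingleton ℝ (E 2) (δ • a)).coprod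
    (LinearMap.toSpanSingleton ℝ (E 2) (δ • b)) with hL
  have hinj : Function.Injective L := by
    refine (injective_iff_map_eq_zero L).2 fun z hz => ?_
    have hz' : (z.1 * δ) • a + (z.2 * δ) • b = 0 := by
      simpa [hL, mul_smul] using hz
    obtain ⟨h1, h2⟩ := hab _ _ hz'
    exact Prod.ext ((mul_eq_zero.1 h1).resolve_right hδ.ne')
      ((mul_eq_zero.1 h2).resolve_right hδ.ne')
  set e : (ℝ × ℝ) ≃L[ℝ] E 2 :=
    (LinearEquiv.ofInjectiveOfFinrankEq L hinj (by simp)).toContinuousLinearEquiv with he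
  have hez (z : ℝ × ℝ) : e z = z.1 • δ • a + z.2 • δ • b := rfl
  refine ⟨V, hV, exists_local_bound hΩ hb e
    ((isCompact_Icc (a := (0 : ℝ)) (b := 1)).prod (isCompact_Icc (a := (0 : ℝ)) (b := 1)))
    (fun x hx z hz => hpar x hx z.1 hz.1 z.2 hz.2)
    -- One factor per side. The 2 arises because the second integration is applied to both w and its
    -- gradient, so first derivatives are counted twice.
    (K := (1 + ‖δ • a‖ₑ) * (2 * (1 + ‖δ • b‖ₑ))) (by finiteness) fun w φ x hx => ?_⟩
  have hxs (s : ℝ) (hs : s ∈ Icc (0 : ℝ) 1) (t : ℝ) (ht : t ∈ Icc (0 : ℝ) 1) :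
      Metric.closedBall (x + s • δ • a + t • δ • b) φ.rOut ⊆ Ω := by
    have := hx (s, t) ⟨hs, ht⟩
    rwa [hez, ← add_assoc] at this
  have hxa (s : ℝ) (hs : s ∈ Icc (0 : ℝ) 1) : Metric.closedBall (x + s • δ • a) φ.rOut ⊆ Ω := by
    simpa using hxs s hs 0 (by simp)
  refine (enorm_moll_le_lintegral_segment hΩ.measurableSet hb φ (H2.hasWeakPartial_fn w) hxa).trans ?_
  rw [mul_assoc]
  gcongr
  have hprod : ∫⁻ z : ℝ × ℝ, mollSum φ w (x + e z) =
      ∫⁻ s : ℝ, ∫⁻ t : ℝ, mollSum φ w (x + s • δ • a + t • δ • b) := by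
    have hme : Measurable fun z : ℝ × ℝ => mollSum φ w (x + e z) :=
      ((continuous_mollSum hΩ.measurableSet hb φ w).comp (by fun_prop)).measurable
    rw [Measure.volume_eq_prod, lintegral_prod _ hme.aemeasurable]
    simp only [hez, add_assoc]
  rw [hprod, ← lintegral_const_mul' _ _ (by finiteness)]
  -- Enlarging the domain of integration to all of ℝ costs nothing, since the mollified sum is
  -- integrable over the whole space with the required bound.
  refine (setLIntegral_mono' measurableSet_Icc fun s hs => ?_).trans (setLIntegral_le_lintegral _ _)
  have hm (g : L2 Ω) : Measurable fun t : ℝ => ‖moll φ g (x + s • δ • a + t • δ • b)‖ₑ :=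
    ((contDiff_moll hΩ.measurableSet hb φ g).continuous.comp (by fun_prop)).enorm.measurable
  have h1 := enorm_moll_le_lintegral_segment hΩ.measurableSet hb φ (H2.hasWeakPartial_fn w) (hxs s hs)
  have h2 (i : Fin 2) :=
    enorm_moll_le_lintegral_segment hΩ.measurableSet hb φ (H2.hasWeakPartial_grad w i) (hxs s hs)
  refine (add_le_add h1 (Finset.sum_le_sum fun i _ => h2 i)).trans ?_
  rw [← Finset.mul_sum, ← mul_add, mul_comm 2, mul_assoc]
  gcongr
  rw [← lintegral_finsetSum _ (by fun_prop), ← lintegral_add_left (by fun_prop),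
    ← lintegral_const_mul' _ _ (by finiteness)]
  refine (setLIntegral_le_lintegral _ _).trans (lintegral_mono fun t => ?_)
  rw [Finset.sum_add_distrib, mollSum, two_mul]
  refine add_le_add le_self_add ?_
  gcongr
  exact le_add_self

/-- The Sobolev embedding of `H²(Ω)` in `L^∞(Ω)` in dimensions one and two. -/
theorem exists_sobolevBound (hn : n = 1 ∨ n = 2) (hΩ : IsOpen Ω) (hb : Bornology.IsBounded Ω)
    (hs : HasSmoothBoundary Ω) : ∃ C : ℝ, 0 < C ∧ SobolevBound Ω C := by
  have hloc : ∀ x₀ ∈ closure Ω, ∃ V ∈ 𝓝 x₀, ∃ C : ℝ, ∀ w : H2 Ω,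
      ∀ᵐ x ∂volume.restrict Ω, x ∈ V → |H2.fn w x| ≤ C * ‖w‖ := by
    rcases hn with rfl | rfl
    · exact exists_bound_near_of_dim_one Ω hΩ hb hs
    · exact exists_bound_near_of_dim_two Ω hΩ hb hs
  have hcpt : IsCompact (closure Ω) := hb.isCompact_closure
  have key : ∃ C : ℝ, ∀ w : H2 Ω, ∀ᵐ x ∂volume.restrict Ω, x ∈ closure Ω → |H2.fn w x| ≤ C * ‖w‖ := by
    -- The property passes to subsets and finite unions and holds near each point, hence on the
    -- compact closure.
    refine hcpt.induction_on (p := fun S => ∃ C : ℝ, ∀ w : H2 Ω, ∀ᵐ x ∂volume.restrict Ω,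
      x ∈ S → |H2.fn w x| ≤ C * ‖w‖) ⟨0, by simp⟩ ?_ ?_ ?_
    · rintro S T hST ⟨C, hC⟩
      exact ⟨C, fun w => (hC w).mono fun x hx hxS => hx (hST hxS)⟩
    · rintro S T ⟨C, hC⟩ ⟨D, hD⟩
      refine ⟨max C D, fun w => ?_⟩
      filter_upwards [hC w, hD w] with x h1 h2 hx
      rcases hx with hx | hx
      · exact (h1 hx).trans (by gcongr; exact le_max_left _ _)
      · exact (h2 hx).trans (by gcongr; exact le_max_right _ _)
    · intro x₀ hx₀
      obtain ⟨V, hV, h⟩ := hloc x₀ hx₀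
      exact ⟨V, mem_nhdsWithin_of_mem_nhds hV, h⟩
  obtain ⟨C, hC⟩ := key
  refine ⟨max C 1, by positivity, fun w => ?_⟩
  filter_upwards [hC w, ae_restrict_mem hΩ.measurableSet] with x h1 h2
  exact (h1 (subset_closure h2)).trans (by gcongr; exact le_max_left _ _)

end Embedding

end MEMS

end

theorem mainTheorem8 (n : ℕ) (hn : n = 1 ∨ n = 2) (Ω : Set (MEMS.E n)) (hΩo : IsOpen Ω)
    (hΩb : Bornology.IsBounded Ω) (hΩs : MEMS.HasSmoothBoundary Ω) :
    ∃ C : ℝ, 0 < C ∧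
      ∀ (w₀ : MEMS.H2 Ω) (κ : ℝ), κ = essInf (MEMS.H2.fn w₀) (volume.restrict Ω) → 0 < κ →
      ∀ r : ℝ, 0 < r → r < κ / (2 * C) →
        (∀ (v : MEMS.Hneg1 Ω), ∀ w ∈ Metric.closedBall w₀ r,
          (∃! u : MEMS.H10 Ω, MEMS.IsWeakSolution Ω v w u) ∧
          (∀ᶠ w' in 𝓝 w, ∀ v' : MEMS.Hneg1 Ω, ∃! u : MEMS.H10 Ω, MEMS.IsWeakSolution Ω v' w' u) ∧
          DifferentiableAt ℝ (fun v' : MEMS.Hneg1 Ω => MEMS.So Ω v' w) v ∧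
          DifferentiableAt ℝ (fun w' : MEMS.H2 Ω => MEMS.So Ω v w') w) ∧
        ∀ (T : ℝ), 0 < T → ∀ (v : ℝ → MEMS.Hneg1 Ω) (w : ℝ → MEMS.H2 Ω),
          ContinuousOn v (Icc 0 T) → ContinuousOn w (Icc 0 T) →
          (∀ t ∈ Icc 0 T, w t ∈ Metric.closedBall w₀ r) →
          Tendsto (MEMS.alpha1 Ω T v w) (𝓝 0) (𝓝 0) ∧
          Tendsto (MEMS.alpha2 Ω T v w) (𝓝 0) (𝓝 0) := by
  obtain ⟨C, h0, hC⟩ := MEMS.exists_sobolevBound hn hΩo hΩb hΩs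
  exact ⟨C, h0, fun w₀ κ hκ hκ0 r _ hr =>
    MEMS.solutionOperator_of_sobolevBound (by omega) hΩo.measurableSet hΩb hC h0 w₀ κ hκ hκ0 r hr⟩
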